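/- **Theorem 4.8 (properties of the minimum relative entropy matching operator).** Let $\Omega$ be a Polish space with its Borel $\sigma$-field (in particular $\Omega=\mathbb{R}^d$ or $\Omega=\mathbb{T}^d=\mathbb{R}^d/\mathbb{Z}^d$), let $\mathcal{P}(\Omega)$ be the set of Borel probability measures on $\Omega$ with the weak topology, and let $R=(R_1,\dots,R_L)^T:\Omega\to\mathbb{R}^L$ be bounded and continuous. *Notation.* $\mathrm{KL}(\nu\|\mu)\in[0,\infty]$ is the relative entropy of $\nu$ with respect to $\mu$. For $\lambda\in\mathbb{R}^L$ and $\mu\in\mathcal{P}(\Omega)$ let $A(\lambda,\mu)=\ln \mathbb{E}_\mu[e^{\lambda^T R}]$ be the log-partition function and $\mathcal{E}(\lambda,\mu)=\exp(\lambda^TR-A(\lambda,\mu))\cdot\mu$. For a closed set $K\subseteq\Omega$ let $\mathrm{Mom}(K)=\{\mathbb{E}_\nu R:\ \nu\in\mathcal{P}(\Omega),\ \nu(\Omega\setminus K)=0\}\subseteq\mathbb{R}^L$. The system $\{1,R_1,\dots,R_L\}$ is *linearly independent modulo $\mu$* if $\mu(\{x:\lambda_0+\lambda^TR(x)=0\})=0$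 for all $(\lambda_0,\lambda)\neq 0$. A pair $(m,\mu)\in\mathbb{R}^L\times\mathcal{P}(\Omega)$ is *nondegenerate* if $\{1,R_1,\dots,R_L\}$ is linearly independent modulo $\mu$ and $m$ lies in the interior of $\mathrm{Mom}(\operatorname{supp}\mu)$. The domain of matching is $$\mathcal{D}=\{(m,\mu):\ (m,\mu)\text{ is nondegenerate, or } m=\mathbb{E}_\mu R\}.$$ The matching $M(m,\mu)$ is the minimiser of $\mathrm{KL}(\nu\|\mu)$ over all $\nu\in\mathcal{P}(\Omega)$ with $\mathbb{E}_\nu R=m$, and the vector of Lagrange multipliers $\lambda(m,\mu)\in\mathbb{R}^L$ is a solution of $\nabla_\lambda A(\lambda(m,\mu),\mu)=m$ (an arbitrary but fixed choice if there are several). *Claim.* For every $(m,\mu)\in\mathcal{D}$ the minimiser $M(m,\mu)$ exists and is unique, $\mathrm{KL}(M(m,\mu)\|\mu)<\infty$, multipliers $\lambda(m,\mu)$ exist, and $M(m,\mu)=\mathcal{E}(\lambda(m,\mu),\mu)$; if $(m,\mu)$ is nondegenerate, then $\lambda(m,\mu)$ is unique. Moreover: (i) For all $(m,\mu)\in\mathcal{D}$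 and all $\nu\in\mathcal{P}(\Omega)$ with $\nu\ll\mu$ and $\mathbb{E}_\nu R=m$, $$\mathrm{KL}(\nu\|\mu)=\mathrm{KL}(\nu\|M(m,\mu))+\mathrm{KL}(M(m,\mu)\|\mu).$$ (ii) The maps $(m,\mu)\mapsto M(m,\mu)\in\mathcal{P}(\Omega)$, $(m,\mu)\mapsto\lambda(m,\mu)\in\mathbb{R}^L$ and $(m,\mu)\mapsto \mathrm{KL}(M(m,\mu)\|\mu)$, defined on $\mathcal{D}\subseteq\mathbb{R}^L\times\mathcal{P}(\Omega)$ with the product of the Euclidean and the weak topology, are continuous at every nondegenerate pair (in particular, they are continuous on the set of nondegenerate pairs). (iii) For every $\mu\in\mathcal{P}(\Omega)$ such that $\{1,R_1,\dots,R_L\}$ is linearly independent modulo $\mu$, and every $m$ in the interior of $\mathrm{Mom}(\operatorname{supp}\mu)$, the Hessian $\nabla^2_\lambda A(\lambda(m,\mu),\mu)$ is invertible, and $m\mapsto\lambda(m,\mu)$ is differentiable at $m$ with $$D_m\lambda(m,\mu)=\big(\nabla^2_\lambda A(\lambda(m,\mu),\mu)\big)^{-1}.$$ (iv) Let $(m,\mu)\in\mathcal{D}$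 be nondegenerate, let $(m,\nu)\in\mathcal{D}$, and put $\eta=\nu-\mu$. For every $\varepsilon\in[0,1)$ the equation $\nabla_\lambda A(\lambda,\mu+\varepsilon\eta)=m$ has a unique solution $\lambda(m,\mu+\varepsilon\eta)$, and the one-sided directional derivative $\partial_\mu\lambda(m,\mu;\eta)=\lim_{\varepsilon\searrow0}\varepsilon^{-1}\big(\lambda(m,\mu+\varepsilon\eta)-\lambda(m,\mu)\big)$ exists and equals $$\partial_\mu\lambda(m,\mu;\eta)=-D_m\lambda(m,\mu)\int_\Omega \exp\!\big(\lambda(m,\mu)^TR-A(\lambda(m,\mu),\mu)\big)\,(R-m)\,d\eta .$$ -/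

import Mathlib

open MeasureTheory InformationTheory Filter Topology
open scoped RealInnerProductSpace

namespace EntropyMatching

variable {Ω : Type*} [MeasurableSpace Ω] {L : ℕ}

/-- Functions `f i` are linearly independent modulo `μ`: every nontrivial linear combination
vanishes only on a `μ`-null set. -/
def LinIndepMod {ι : Type*} [Fintype ι] (f : ι → Ω → ℝ) (μ : Measure Ω) : Prop :=
  ∀ c : ι → ℝ, c ≠ 0 → μ {x | ∑ i, c i * f i x = 0} = 0

/-- The system `{1, R₁, …, R_L}` of restriction functions enlarged by the constant function. -/
def withOne (R : Ω → EuclideanSpace ℝ (Fin L)) : Fin (L + 1) → Ω → ℝ :=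
  Fin.cons (fun _ => 1) (fun i x => R x i)

/-- The moment space of a (measurable) set `K`: the moment vectors of all probability measures
carried by `K`. -/
def momentSpace (K : Set Ω) (R : Ω → EuclideanSpace ℝ (Fin L)) :
    Set (EuclideanSpace ℝ (Fin L)) :=
  {m | ∃ ν : ProbabilityMeasure Ω, (ν : Measure Ω) Kᶜ = 0 ∧ ∫ x, R x ∂(ν : Measure Ω) = m}

/-- The log-partition function `A(l, μ) = log E_μ[exp(l ⬝ R)]`. -/
noncomputable def logPartition (R : Ω → EuclideanSpace ℝ (Fin L))
    (l : EuclideanSpace ℝ (Fin L)) (μ : Measure Ω) : ℝ :=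
  Real.log (∫ x, Real.exp ⟪l, R x⟫ ∂μ)

/-- The member `exp(l ⬝ R - A(l, μ)) ⬝ μ` of the exponential family with respect to `μ`
(for `Measure.tilted`, the density is `exp(l ⬝ R) / E_μ[exp(l ⬝ R)]`). -/
noncomputable def expFamily (R : Ω → EuclideanSpace ℝ (Fin L))
    (l : EuclideanSpace ℝ (Fin L)) (μ : Measure Ω) : Measure Ω :=
  μ.tilted (fun x => ⟪l, R x⟫)

/-- The Lagrange multiplier equation `∇ A(·, μ)(l) = m`. -/
def IsMultiplier (R : Ω → EuclideanSpace ℝ (Fin L)) (m : EuclideanSpace ℝ (Fin L))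
    (μ : Measure Ω) (l : EuclideanSpace ℝ (Fin L)) : Prop :=
  HasGradientAt (fun l' => logPartition R l' μ) m l

open Classical in
/-- The Lagrange multipliers `λ(m, μ)`: a solution of `∇ A(·, μ)(λ) = m`
(and `0` if there is none). -/
noncomputable def multiplier (R : Ω → EuclideanSpace ℝ (Fin L))
    (m : EuclideanSpace ℝ (Fin L)) (μ : Measure Ω) : EuclideanSpace ℝ (Fin L) :=
  if h : ∃ l, IsMultiplier R m μ l then h.choose else 0

/-- The Hessian of the log-partition function in its first variable, as a linear operator:
the derivative of the gradient. -/
noncomputable def hessLogPartition (R : Ω → EuclideanSpace ℝ (Fin L))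
    (l : EuclideanSpace ℝ (Fin L)) (μ : Measure Ω) :
    EuclideanSpace ℝ (Fin L) →L[ℝ] EuclideanSpace ℝ (Fin L) :=
  fderiv ℝ (fun l' => gradient (fun l'' => logPartition R l'' μ) l') l

/-- `ν` minimises the relative entropy with respect to `μ` among all probability measures with
moment vector `m`. (`klDiv ν μ` is the relative entropy of `ν` with respect to `μ`.) -/
def IsMatching (R : Ω → EuclideanSpace ℝ (Fin L)) (m : EuclideanSpace ℝ (Fin L))
    (μ ν : ProbabilityMeasure Ω) : Prop :=
  ∫ x, R x ∂(ν : Measure Ω) = m ∧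
    ∀ ρ : ProbabilityMeasure Ω, ∫ x, R x ∂(ρ : Measure Ω) = m →
      klDiv (ν : Measure Ω) (μ : Measure Ω) ≤ klDiv (ρ : Measure Ω) (μ : Measure Ω)

open Classical in
/-- The matching operator `M(m, μ)`: the minimiser of the relative entropy with respect to `μ`
under the moment constraint `m` (and `μ` if there is none). -/
noncomputable def matching (R : Ω → EuclideanSpace ℝ (Fin L)) (m : EuclideanSpace ℝ (Fin L))
    (μ : ProbabilityMeasure Ω) : ProbabilityMeasure Ω :=
  if h : ∃ ν, IsMatching R m μ ν then h.choose else μ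

/-- The nondegenerate pairs `(m, μ)`: the system `{1, R₁, …, R_L}` is linearly independent
modulo `μ`, and `m` is an interior point of the moment space of `supp μ`. -/
def regularDomain [TopologicalSpace Ω] (R : Ω → EuclideanSpace ℝ (Fin L)) :
    Set (EuclideanSpace ℝ (Fin L) × ProbabilityMeasure Ω) :=
  {p | LinIndepMod (withOne R) (p.2 : Measure Ω) ∧
    p.1 ∈ interior (momentSpace (p.2 : Measure Ω).support R)}

/-- The domain of the matching operator: the nondegenerate pairs, together with all pairs
`(m, μ)` for which `m` is the moment vector of `μ`. -/
def matchDomain [TopologicalSpace Ω] (R : Ω → EuclideanSpace ℝ (Fin L)) :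
    Set (EuclideanSpace ℝ (Fin L) × ProbabilityMeasure Ω) :=
  regularDomain R ∪ {p | p.1 = ∫ x, R x ∂(p.2 : Measure Ω)}

/-- The measure `μ + ε (ν - μ) = (1 - ε) μ + ε ν`, for `ε ∈ [0, 1]`. -/
noncomputable def segment (μ ν : Measure Ω) (ε : ℝ) : Measure Ω :=
  ENNReal.ofReal (1 - ε) • μ + ENNReal.ofReal ε • ν

/-- `F` has the one-sided directional derivative `v` at `μ` in the direction `ν - μ`. -/
def HasDirDeriv {V : Type*} [NormedAddCommGroup V] [NormedSpace ℝ V]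
    (F : Measure Ω → V) (μ ν : Measure Ω) (v : V) : Prop :=
  Tendsto (fun ε : ℝ => ε⁻¹ • (F (segment μ ν ε) - F μ)) (𝓝[>] 0) (𝓝 v)

end EntropyMatching

/-! Fix `m` and put `Z(l) = ∫ exp ⟪l, R - m⟫ dμ = exp(A(l, μ) - ⟪l, m⟫)`. This is a smooth convex
function whose critical points are exactly the multipliers, so everything reduces to minimising `Z`.
The notion that drives the proof is `Spread`: `R - m` does not lie `μ`-a.e. in a closed half-space
with `0` on its boundary. It holds when `m` is interior to the moment space of the support
(`spread_of_mem_interior_momentSpace`). It makes `Z` grow at least linearly, so a minimiser exists,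
and it makes that minimiser unique. In the degenerate case `m = E_μ R`, `l = 0` is a multiplier.

Given a multiplier `l`, the log-density of `expFamily R l μ` is affine in `R`, so its integral under
any `ν` depends only on the moments of `ν`. This is the Pythagorean identity, and it makes the
tilted measure the unique minimiser of the relative entropy, whichever multiplier was chosen.

Continuity is stability of minimisers of convex functions (`continuousWithinAt_of_convex_min`),
since `Z` is jointly continuous in `(m, μ, l)`. The Hessian of `A` at a multiplier is the covariance
of `R` under the tilted measure, positive definite by `Spread`; the multiplier map is a continuous
local right inverse of the gradient, which gives (iii).

For (iv), the multiplier of a segment point is also the multiplier of `μ` itself for a shifted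
moment `M ε`. The right derivative of `M` at `0` is explicit, and the chain rule with (iii)
concludes. -/

namespace EntropyMatching

/-! ### Exponential integrals: differentiation, convexity, critical points. -/

section ExpIntegral

variable {Ω E F : Type*} [MeasurableSpace Ω] [NormedAddCommGroup E] [InnerProductSpace ℝ E]
  [NormedAddCommGroup F] [NormedSpace ℝ F] {Y : Ω → E} {g : Ω → F} {μ : Measure Ω} {C D : ℝ}

theorem aestronglyMeasurable_exp_inner_smul (hY : AEStronglyMeasurable Y μ)
    (hg : AEStronglyMeasurable g μ) (l : E) :
    AEStronglyMeasurable (fun x => Real.exp ⟪l, Y x⟫ • g x) μ :=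
  (Real.continuous_exp.comp_aestronglyMeasurable (aestronglyMeasurable_const.inner hY)).smul hg

theorem exp_inner_le {y l : E} {r : ℝ} (hy : ‖y‖ ≤ C) (hl : ‖l‖ ≤ r) :
    Real.exp ⟪l, y⟫ ≤ Real.exp (r * C) :=
  Real.exp_le_exp.2 ((real_inner_le_norm l y).trans
    (mul_le_mul hl hy (norm_nonneg _) ((norm_nonneg _).trans hl)))

theorem integrable_exp_inner_smul [IsFiniteMeasure μ] (hY : AEStronglyMeasurable Y μ)
    (hYC : ∀ x, ‖Y x‖ ≤ C) (hg : AEStronglyMeasurable g μ) (hgD : ∀ x, ‖g x‖ ≤ D) (l : E) :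
    Integrable (fun x => Real.exp ⟪l, Y x⟫ • g x) μ := by
  refine Integrable.of_bound (aestronglyMeasurable_exp_inner_smul hY hg l)
    (Real.exp (‖l‖ * C) * D) (ae_of_all _ fun x => ?_)
  rw [norm_smul, Real.norm_of_nonneg (Real.exp_nonneg _)]
  exact mul_le_mul (exp_inner_le (hYC x) le_rfl) (hgD x) (norm_nonneg _) (Real.exp_nonneg _)

theorem integrable_exp_inner [IsFiniteMeasure μ] (hY : AEStronglyMeasurable Y μ)
    (hYC : ∀ x, ‖Y x‖ ≤ C) (l : E) : Integrable (fun x => Real.exp ⟪l, Y x⟫) μ := by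
  simpa using integrable_exp_inner_smul (g := fun _ => (1 : ℝ)) (D := 1) hY hYC
    aestronglyMeasurable_const (by simp) l

/-- Differentiation of `l ↦ ∫ exp ⟪l, Y⟫ • g ∂μ` under the integral sign. -/
theorem hasFDerivAt_integral_exp_inner_smul [IsFiniteMeasure μ]
    (hY : AEStronglyMeasurable Y μ) (hYC : ∀ x, ‖Y x‖ ≤ C) (hg : AEStronglyMeasurable g μ)
    (hgD : ∀ x, ‖g x‖ ≤ D) (l : E) :
    HasFDerivAt (fun l => ∫ x, Real.exp ⟪l, Y x⟫ • g x ∂μ)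
      (∫ x, Real.exp ⟪l, Y x⟫ • (innerSL ℝ (Y x)).smulRight (g x) ∂μ) l := by
  refine hasFDerivAt_integral_of_dominated_of_fderiv_le
    (F' := fun l x => Real.exp ⟪l, Y x⟫ • (innerSL ℝ (Y x)).smulRight (g x))
    -- Domination is only needed on the unit ball around `l`, where `‖l'‖ ≤ ‖l‖ + 1`.
    (bound := fun _ => Real.exp ((‖l‖ + 1) * C) * (C * D))
    (Metric.ball_mem_nhds l one_pos)
    (Eventually.of_forall fun l' => aestronglyMeasurable_exp_inner_smul hY hg l')
    (integrable_exp_inner_smul hY hYC hg hgD l) ?_ ?_ (integrable_const _) ?_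
  · refine aestronglyMeasurable_exp_inner_smul hY ?_ l
    have h : Continuous fun p : E × F => (innerSL ℝ p.1).smulRight p.2 := by fun_prop
    exact h.comp_aestronglyMeasurable (hY.prodMk hg)
  · refine ae_of_all _ fun x l' hl' => ?_
    have hl : ‖l'‖ ≤ ‖l‖ + 1 := by
      have h1 := norm_le_norm_add_norm_sub l l'
      have h2 : ‖l' - l‖ < 1 := by simpa [dist_eq_norm] using hl'
      rw [← norm_sub_rev] at h2
      linarith
    rw [norm_smul, Real.norm_of_nonneg (Real.exp_nonneg _), ContinuousLinearMap.norm_smulRight_apply,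
      innerSL_apply_norm]
    exact mul_le_mul (exp_inner_le (hYC x) hl)
      (mul_le_mul (hYC x) (hgD x) (norm_nonneg _) ((norm_nonneg _).trans (hYC x)))
      (by positivity) (Real.exp_nonneg _)
  · refine ae_of_all _ fun x l' _ => ?_
    have h1 : HasFDerivAt (fun l : E => ⟪l, Y x⟫) (innerSL ℝ (Y x)) l' := by
      refine (innerSL ℝ (Y x)).hasFDerivAt.congr_of_eventuallyEq (Eventually.of_forall fun z => ?_)
      simp [real_inner_comm]
    refine (h1.exp.smul_const (g x)).congr_fderiv ?_
    ext v
    simp [smul_smul]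

theorem continuous_integral_exp_inner_smul [IsFiniteMeasure μ]
    (hY : AEStronglyMeasurable Y μ) (hYC : ∀ x, ‖Y x‖ ≤ C) (hg : AEStronglyMeasurable g μ)
    (hgD : ∀ x, ‖g x‖ ≤ D) : Continuous fun l : E => ∫ x, Real.exp ⟪l, Y x⟫ • g x ∂μ :=
  continuous_iff_continuousAt.2 fun l =>
    (hasFDerivAt_integral_exp_inner_smul hY hYC hg hgD l).continuousAt

theorem continuous_integral_exp_inner [IsFiniteMeasure μ]
    (hY : AEStronglyMeasurable Y μ) (hYC : ∀ x, ‖Y x‖ ≤ C) :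
    Continuous fun l : E => ∫ x, Real.exp ⟪l, Y x⟫ ∂μ := by
  simpa using continuous_integral_exp_inner_smul (g := fun _ => (1 : ℝ)) (D := 1) hY hYC
    aestronglyMeasurable_const (by simp)

theorem hasGradientAt_integral_exp_inner [CompleteSpace E] [IsFiniteMeasure μ]
    (hY : AEStronglyMeasurable Y μ) (hYC : ∀ x, ‖Y x‖ ≤ C) (l : E) :
    HasGradientAt (fun l => ∫ x, Real.exp ⟪l, Y x⟫ ∂μ) (∫ x, Real.exp ⟪l, Y x⟫ • Y x ∂μ) l := by
  have h := hasFDerivAt_integral_exp_inner_smul (g := fun _ => (1 : ℝ)) (D := 1) hY hYC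
    aestronglyMeasurable_const (by simp) l
  simp only [smul_eq_mul, mul_one] at h
  rw [hasGradientAt_iff_hasFDerivAt]
  refine h.congr_fderiv ?_
  have hm : AEStronglyMeasurable (fun x => (innerSL ℝ (Y x)).smulRight (1 : ℝ)) μ := by
    have h : Continuous fun y : E => (innerSL ℝ y).smulRight (1 : ℝ) := by fun_prop
    exact h.comp_aestronglyMeasurable hY
  ext v
  symm
  rw [ContinuousLinearMap.integral_apply
    (integrable_exp_inner_smul (D := C) hY hYC hm (fun x => by simpa using hYC x) l)]
  rw [InnerProductSpace.toDual_apply_apply, real_inner_comm,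
    ← integral_inner (integrable_exp_inner_smul hY hYC hY hYC l)]
  refine integral_congr_ae (ae_of_all _ fun x => ?_)
  simp [inner_smul_right, real_inner_comm]

theorem convexOn_integral_exp_inner [IsFiniteMeasure μ]
    (hY : AEStronglyMeasurable Y μ) (hYC : ∀ x, ‖Y x‖ ≤ C) :
    ConvexOn ℝ Set.univ fun l : E => ∫ x, Real.exp ⟪l, Y x⟫ ∂μ := by
  refine ⟨convex_univ, fun l _ l' _ a b ha hb hab => ?_⟩
  have hi := integrable_exp_inner (μ := μ) hY hYC
  simp only [smul_eq_mul]
  rw [← integral_const_mul, ← integral_const_mul,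
    ← integral_add ((hi l).const_mul _) ((hi l').const_mul _)]
  refine integral_mono (hi _) (((hi l).const_mul _).add ((hi l').const_mul _)) fun x => ?_
  have := convexOn_exp.2 (Set.mem_univ ⟪l, Y x⟫) (Set.mem_univ ⟪l', Y x⟫) ha hb hab
  simpa [inner_add_left, inner_smul_left] using this

/-- A critical point of `l ↦ ∫ exp ⟪l, Y⟫ ∂μ` is a minimiser. -/
theorem integral_exp_inner_le_of_critical [CompleteSpace E] [IsFiniteMeasure μ]
    (hY : AEStronglyMeasurable Y μ) (hYC : ∀ x, ‖Y x‖ ≤ C) {l : E}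
    (hl : ∫ x, Real.exp ⟪l, Y x⟫ • Y x ∂μ = 0) (l' : E) :
    ∫ x, Real.exp ⟪l, Y x⟫ ∂μ ≤ ∫ x, Real.exp ⟪l', Y x⟫ ∂μ := by
  have hi := integrable_exp_inner (μ := μ) hY hYC
  have hj := integrable_exp_inner_smul hY hYC hY hYC l
  have h0 : ∫ x, ⟪l' - l, Real.exp ⟪l, Y x⟫ • Y x⟫ ∂μ = 0 := by
    rw [integral_inner hj, hl, inner_zero_right]
  calc ∫ x, Real.exp ⟪l, Y x⟫ ∂μ
      = ∫ x, (Real.exp ⟪l, Y x⟫ + ⟪l' - l, Real.exp ⟪l, Y x⟫ • Y x⟫) ∂μ := by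
        rw [integral_add (hi l) (hj.const_inner _), h0, add_zero]
    _ ≤ _ := by
        refine integral_mono ((hi l).add (hj.const_inner _)) (hi l') fun x => ?_
        -- Tangent-line inequality for `exp` at `⟪l, Y x⟫`; the linear term integrates to zero at a
        -- critical point.
        have h := Real.add_one_le_exp (⟪l', Y x⟫ - ⟪l, Y x⟫)
        have h2 : Real.exp ⟪l', Y x⟫ =
            Real.exp ⟪l, Y x⟫ * Real.exp (⟪l', Y x⟫ - ⟪l, Y x⟫) := by
          rw [← Real.exp_add]; congr 1; ring
        simp only [inner_smul_right, inner_sub_left]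
        rw [h2]
        nlinarith [Real.exp_pos ⟪l, Y x⟫]

theorem critical_of_integral_exp_inner_le [CompleteSpace E] [IsFiniteMeasure μ]
    (hY : AEStronglyMeasurable Y μ) (hYC : ∀ x, ‖Y x‖ ≤ C) {l : E}
    (hl : ∀ l', ∫ x, Real.exp ⟪l, Y x⟫ ∂μ ≤ ∫ x, Real.exp ⟪l', Y x⟫ ∂μ) :
    ∫ x, Real.exp ⟪l, Y x⟫ • Y x ∂μ = 0 := by
  have h := hasGradientAt_integral_exp_inner hY hYC l
  rw [hasGradientAt_iff_hasFDerivAt] at h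
  have h0 := IsLocalMin.hasFDerivAt_eq_zero (Eventually.of_forall hl) h
  simpa using h0

/-- Two critical points of `l ↦ ∫ exp ⟪l, Y⟫ ∂μ` differ by a vector orthogonal to `Y`
almost everywhere. -/
theorem ae_inner_sub_eq_zero_of_critical [CompleteSpace E] [IsFiniteMeasure μ]
    (hY : AEStronglyMeasurable Y μ) (hYC : ∀ x, ‖Y x‖ ≤ C) {l l' : E}
    (hl : ∫ x, Real.exp ⟪l, Y x⟫ • Y x ∂μ = 0) (hl' : ∫ x, Real.exp ⟪l', Y x⟫ • Y x ∂μ = 0) :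
    ∀ᵐ x ∂μ, ⟪l' - l, Y x⟫ = 0 := by
  have hj := integrable_exp_inner_smul hY hYC hY hYC
  have hk := fun z => (hj z).const_inner (𝕜 := ℝ) (l' - l)
  have hint := (hk l').sub (hk l)
  -- Monotonicity of the gradient: the integrand `(b - a)(exp b - exp a)` is nonnegative and
  -- vanishes only where `a = b`.
  have key : ∀ x, ⟪l' - l, Real.exp ⟪l', Y x⟫ • Y x⟫ - ⟪l' - l, Real.exp ⟪l, Y x⟫ • Y x⟫ =
      (⟪l', Y x⟫ - ⟪l, Y x⟫) * (Real.exp ⟪l', Y x⟫ - Real.exp ⟪l, Y x⟫) := fun x => by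
    simp only [inner_smul_right, inner_sub_left]; ring
  have h0 : ∫ x, (⟪l' - l, Real.exp ⟪l', Y x⟫ • Y x⟫ -
      ⟪l' - l, Real.exp ⟪l, Y x⟫ • Y x⟫) ∂μ = 0 := by
    rw [integral_sub (hk l') (hk l), integral_inner (hj l'),
      integral_inner (hj l), hl, hl', sub_self]
  have hnn : ∀ x, 0 ≤ ⟪l' - l, Real.exp ⟪l', Y x⟫ • Y x⟫ -
      ⟪l' - l, Real.exp ⟪l, Y x⟫ • Y x⟫ := fun x => by
    rw [key]
    rcases le_total ⟪l, Y x⟫ ⟪l', Y x⟫ with h | h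
    · exact mul_nonneg (sub_nonneg.2 h) (sub_nonneg.2 (Real.exp_le_exp.2 h))
    · exact mul_nonneg_of_nonpos_of_nonpos (sub_nonpos.2 h) (sub_nonpos.2 (Real.exp_le_exp.2 h))
  filter_upwards [(integral_eq_zero_iff_of_nonneg hnn hint).1 h0] with x hx
  rw [key] at hx
  rw [inner_sub_left]
  rcases mul_eq_zero.1 hx with h | h
  · exact h
  · rw [sub_eq_zero] at h ⊢
    exact Real.exp_injective h

end ExpIntegral

/-! ### Spread vector fields: coercivity, existence and uniqueness of critical points. -/

section Spread

variable {Ω E : Type*} [MeasurableSpace Ω] [NormedAddCommGroup E] [InnerProductSpace ℝ E]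
  {Y : Ω → E} {μ : Measure Ω} {C : ℝ}

/-- `Y` is not carried, modulo `μ`, by any closed half-space with `0` on its boundary. -/
def Spread (Y : Ω → E) (μ : Measure Ω) : Prop :=
  ∀ u : E, u ≠ 0 → ¬ ∀ᵐ x ∂μ, ⟪u, Y x⟫ ≤ 0

theorem Spread.mono_ac {ν : Measure Ω} (h : Spread Y μ) (hac : μ ≪ ν) : Spread Y ν :=
  fun u hu hx => h u hu (hac.ae_le hx)

theorem Spread.eq_zero (h : Spread Y μ) {u : E} (hu : ∀ᵐ x ∂μ, ⟪u, Y x⟫ = 0) : u = 0 := by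
  by_contra hne
  exact h u hne (hu.mono fun x hx => hx.le)

theorem Spread.critical_unique [CompleteSpace E] [IsFiniteMeasure μ] (h : Spread Y μ)
    (hY : AEStronglyMeasurable Y μ) (hYC : ∀ x, ‖Y x‖ ≤ C) {l l' : E}
    (hl : ∫ x, Real.exp ⟪l, Y x⟫ • Y x ∂μ = 0) (hl' : ∫ x, Real.exp ⟪l', Y x⟫ • Y x ∂μ = 0) :
    l' = l :=
  sub_eq_zero.1 (h.eq_zero (ae_inner_sub_eq_zero_of_critical hY hYC hl hl'))

theorem Spread.integral_exp_inner_lt [CompleteSpace E] [IsFiniteMeasure μ] (h : Spread Y μ)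
    (hY : AEStronglyMeasurable Y μ) (hYC : ∀ x, ‖Y x‖ ≤ C) {l l' : E}
    (hl : ∫ x, Real.exp ⟪l, Y x⟫ • Y x ∂μ = 0) (hne : l' ≠ l) :
    ∫ x, Real.exp ⟪l, Y x⟫ ∂μ < ∫ x, Real.exp ⟪l', Y x⟫ ∂μ := by
  have hmin := integral_exp_inner_le_of_critical hY hYC hl
  refine lt_of_le_of_ne (hmin l') fun heq => hne ?_
  exact h.critical_unique hY hYC hl
    (critical_of_integral_exp_inner_le hY hYC fun z => heq ▸ hmin z)

/-- The function `u ↦ ∫ max ⟪u, Y⟫ 0` is continuous on the compact unit sphere, and positive there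
by `Spread`, hence bounded below by some `c > 0`. Homogeneity and `exp t ≥ max t 0` transfer the
bound to all `l`. -/
theorem Spread.exists_mul_norm_le [FiniteDimensional ℝ E] [IsFiniteMeasure μ] (h : Spread Y μ)
    (hY : AEStronglyMeasurable Y μ) (hYC : ∀ x, ‖Y x‖ ≤ C) :
    ∃ c > 0, ∀ l : E, c * ‖l‖ ≤ ∫ x, Real.exp ⟪l, Y x⟫ ∂μ := by
  have hmeas : ∀ u : E, AEStronglyMeasurable (fun x => max ⟪u, Y x⟫ 0) μ := fun u =>
    (continuous_id.max continuous_const).comp_aestronglyMeasurable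
      (aestronglyMeasurable_const.inner hY)
  have hb : ∀ u x, ‖max ⟪u, Y x⟫ 0‖ ≤ ‖u‖ * C := fun u x => by
    rw [Real.norm_of_nonneg (le_max_right _ _)]
    exact max_le ((real_inner_le_norm _ _).trans
      (mul_le_mul_of_nonneg_left (hYC x) (norm_nonneg _)))
      (mul_nonneg (norm_nonneg _) ((norm_nonneg _).trans (hYC x)))
  have hint : ∀ u : E, Integrable (fun x => max ⟪u, Y x⟫ 0) μ := fun u =>
    Integrable.of_bound (hmeas u) _ (ae_of_all _ (hb u))
  have hcont : ContinuousOn (fun u : E => ∫ x, max ⟪u, Y x⟫ 0 ∂μ) (Metric.sphere 0 1) := by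
    refine continuousOn_of_dominated (bound := fun _ => C) (fun u _ => hmeas u) ?_
      (integrable_const _) ?_
    · intro u hu
      refine ae_of_all _ fun x => ?_
      have := hb u x
      rwa [mem_sphere_zero_iff_norm.1 hu, one_mul] at this
    · exact ae_of_all _ fun x => by fun_prop
  have hpos : ∀ u ∈ Metric.sphere (0 : E) 1, 0 < ∫ x, max ⟪u, Y x⟫ 0 ∂μ := by
    intro u hu
    refine lt_of_le_of_ne (integral_nonneg fun x => le_max_right _ _) fun h0 => ?_
    have h1 := (integral_eq_zero_iff_of_nonneg (fun x => le_max_right _ _) (hint u)).1 h0.symm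
    refine h u (ne_zero_of_mem_unit_sphere ⟨u, hu⟩) ?_
    filter_upwards [h1] with x hx
    exact max_eq_right_iff.1 hx
  obtain ⟨c, hc, hcle⟩ := (isCompact_sphere (0 : E) 1).exists_forall_le' hcont hpos
  refine ⟨c, hc, fun l => ?_⟩
  rcases eq_or_ne l 0 with rfl | hl
  · rw [norm_zero, mul_zero]
    exact integral_nonneg fun x => Real.exp_nonneg _
  have hn : 0 < ‖l‖ := norm_pos_iff.2 hl
  have h1 := hcle (‖l‖⁻¹ • l) (by simp [norm_smul, hn.ne'])
  calc c * ‖l‖ ≤ (∫ x, max ⟪‖l‖⁻¹ • l, Y x⟫ 0 ∂μ) * ‖l‖ :=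
        mul_le_mul_of_nonneg_right h1 hn.le
    _ = ∫ x, max ⟪‖l‖⁻¹ • l, Y x⟫ 0 * ‖l‖ ∂μ := (integral_mul_const _ _).symm
    _ ≤ _ := by
        refine integral_mono ((hint _).mul_const _) (integrable_exp_inner hY hYC l) fun x => ?_
        have h2 : max ⟪‖l‖⁻¹ • l, Y x⟫ 0 * ‖l‖ = max ⟪l, Y x⟫ 0 := by
          rw [max_mul_of_nonneg _ _ hn.le, zero_mul, real_inner_smul_left]
          congr 1
          field_simp
        simp only [h2]
        exact max_le (by linarith [Real.add_one_le_exp ⟪l, Y x⟫]) (Real.exp_nonneg _)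

theorem Spread.exists_critical [FiniteDimensional ℝ E] [IsFiniteMeasure μ] (h : Spread Y μ)
    (hY : AEStronglyMeasurable Y μ) (hYC : ∀ x, ‖Y x‖ ≤ C) :
    ∃ l : E, ∫ x, Real.exp ⟪l, Y x⟫ • Y x ∂μ = 0 := by
  have : CompleteSpace E := FiniteDimensional.complete ℝ E
  obtain ⟨c, hc, hcle⟩ := h.exists_mul_norm_le hY hYC
  have hlim : Tendsto (fun l : E => ∫ x, Real.exp ⟪l, Y x⟫ ∂μ) (cocompact E) atTop :=
    tendsto_atTop_mono hcle ((tendsto_norm_cocompact_atTop (E := E)).const_mul_atTop hc)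
  obtain ⟨l, hl⟩ := (continuous_integral_exp_inner hY hYC).exists_forall_le hlim
  exact ⟨l, critical_of_integral_exp_inner_le hY hYC hl⟩

end Spread

/-- Stability of minimisers of convex functions under perturbation: minimisers of convex functions
`Z t`, `t ∈ s`, depend continuously on `t` at a parameter with a strict minimiser. -/
theorem continuousWithinAt_of_convex_min {T E : Type*} [TopologicalSpace T]
    [NormedAddCommGroup E] [NormedSpace ℝ E] [ProperSpace E] {Z : T → E → ℝ}
    (hZ : Continuous fun p : T × E => Z p.1 p.2) {s : Set T} {l : T → E} {t₀ : T}
    (hconv : ∀ t ∈ s, ConvexOn ℝ Set.univ (Z t)) (hmin : ∀ t ∈ s, ∀ l', Z t (l t) ≤ Z t l')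
    (hstrict : ∀ l', l' ≠ l t₀ → Z t₀ (l t₀) < Z t₀ l') : ContinuousWithinAt l s t₀ := by
  rw [Metric.continuousWithinAt_iff']
  intro r hr
  have hopen : IsOpen {p : T × E | Z p.1 (l t₀) < Z p.1 p.2} :=
    isOpen_lt (hZ.comp (continuous_fst.prodMk continuous_const)) hZ
  -- By compactness of the sphere of radius `r`, the strict inequality there persists for all `t`
  -- near `t₀`.
  obtain ⟨u, v, hu, -, hu0, hv, huv⟩ := generalized_tube_lemma (isCompact_singleton (x := t₀))
    (isCompact_sphere (l t₀) r) hopen (by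
      rintro ⟨t, x⟩ ⟨ht, hx⟩
      obtain rfl : t = t₀ := ht
      refine hstrict x fun h => ?_
      subst h
      exact hr.ne (by simpa using hx))
  filter_upwards [self_mem_nhdsWithin,
    mem_nhdsWithin_of_mem_nhds (hu.mem_nhds (hu0 rfl))] with t hts htu
  by_contra! hle
  have hd : 0 < dist (l t) (l t₀) := hr.trans_le hle
  -- If `l t` lay outside the ball, the segment from `l t₀` to `l t` would cross the sphere at
  -- parameter `a`. Convexity bounds the value there by `Z t (l t₀)`, a contradiction.
  set a := r / dist (l t) (l t₀) with ha
  have ha0 : 0 ≤ a := by positivity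
  have ha1 : a ≤ 1 := (div_le_one hd).2 hle
  have hp : (1 - a) • l t₀ + a • l t ∈ Metric.sphere (l t₀) r := by
    have : (1 - a) • l t₀ + a • l t - l t₀ = a • (l t - l t₀) := by module
    rw [mem_sphere_iff_norm, this, norm_smul, Real.norm_of_nonneg ha0, ← dist_eq_norm, ha,
      div_mul_cancel₀ _ hd.ne']
  have h1 : Z t (l t₀) < Z t ((1 - a) • l t₀ + a • l t) := huv (Set.mk_mem_prod htu (hv hp))
  have h2 := (hconv t hts).2 (Set.mem_univ (l t₀)) (Set.mem_univ (l t)) (sub_nonneg.2 ha1) ha0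
    (by ring)
  have h3 := hmin t hts (l t₀)
  simp only [smul_eq_mul] at h2
  nlinarith

theorem norm_sub_le_of_norm_le {Ω E : Type*} [NormedAddCommGroup E] {R : Ω → E} {C : ℝ}
    (hRC : ∀ x, ‖R x‖ ≤ C) (m : E) (x : Ω) : ‖R x - m‖ ≤ C + ‖m‖ :=
  (norm_sub_le _ _).trans (add_le_add_left (hRC x) _)

/-! ### Multipliers, the exponential family and the Pythagorean identity. -/

section Multiplier

variable {Ω : Type*} [MeasurableSpace Ω] {L : ℕ} {R : Ω → EuclideanSpace ℝ (Fin L)}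
  {μ ν : Measure Ω} {m l : EuclideanSpace ℝ (Fin L)} {C : ℝ}

theorem integral_exp_inner_pos [IsProbabilityMeasure μ] (hR : StronglyMeasurable R)
    (hRC : ∀ x, ‖R x‖ ≤ C) (l : EuclideanSpace ℝ (Fin L)) : 0 < ∫ x, Real.exp ⟪l, R x⟫ ∂μ :=
  integral_exp_pos (integrable_exp_inner hR.aestronglyMeasurable hRC l)

theorem hasGradientAt_logPartition [IsProbabilityMeasure μ] (hR : StronglyMeasurable R)
    (hRC : ∀ x, ‖R x‖ ≤ C) (l : EuclideanSpace ℝ (Fin L)) :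
    HasGradientAt (fun l => logPartition R l μ)
      ((∫ x, Real.exp ⟪l, R x⟫ ∂μ)⁻¹ • ∫ x, Real.exp ⟪l, R x⟫ • R x ∂μ) l := by
  have h := hasGradientAt_integral_exp_inner (μ := μ) hR.aestronglyMeasurable hRC l
  rw [hasGradientAt_iff_hasFDerivAt] at h ⊢
  refine (h.log (integral_exp_inner_pos hR hRC l).ne').congr_fderiv ?_
  simp

theorem integral_exp_inner_smul_sub [IsProbabilityMeasure μ] (hR : StronglyMeasurable R)
    (hRC : ∀ x, ‖R x‖ ≤ C) (m l : EuclideanSpace ℝ (Fin L)) :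
    ∫ x, Real.exp ⟪l, R x⟫ • (R x - m) ∂μ =
      ∫ x, Real.exp ⟪l, R x⟫ • R x ∂μ - (∫ x, Real.exp ⟪l, R x⟫ ∂μ) • m := by
  have hR' := hR.aestronglyMeasurable (μ := μ)
  simp_rw [smul_sub]
  rw [integral_sub (integrable_exp_inner_smul hR' hRC hR' hRC l)
    ((integrable_exp_inner hR' hRC l).smul_const m), integral_smul_const]

theorem exp_inner_sub (l r m : EuclideanSpace ℝ (Fin L)) :
    Real.exp ⟪l, r - m⟫ = Real.exp (-⟪l, m⟫) * Real.exp ⟪l, r⟫ := by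
  rw [← Real.exp_add, inner_sub_right]; congr 1; ring

theorem integral_exp_inner_sub (R : Ω → EuclideanSpace ℝ (Fin L)) (μ : Measure Ω)
    (m l : EuclideanSpace ℝ (Fin L)) :
    ∫ x, Real.exp ⟪l, R x - m⟫ ∂μ = Real.exp (-⟪l, m⟫) * ∫ x, Real.exp ⟪l, R x⟫ ∂μ := by
  simp_rw [exp_inner_sub, integral_const_mul]

theorem integral_exp_inner_sub_smul (R : Ω → EuclideanSpace ℝ (Fin L)) (μ : Measure Ω)
    (m l : EuclideanSpace ℝ (Fin L)) :
    ∫ x, Real.exp ⟪l, R x - m⟫ • (R x - m) ∂μ =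
      Real.exp (-⟪l, m⟫) • ∫ x, Real.exp ⟪l, R x⟫ • (R x - m) ∂μ := by
  simp_rw [exp_inner_sub, mul_smul, integral_smul]

theorem gradient_logPartition_sub [IsProbabilityMeasure μ] (hR : StronglyMeasurable R)
    (hRC : ∀ x, ‖R x‖ ≤ C) (m l : EuclideanSpace ℝ (Fin L)) :
    gradient (fun l => logPartition R l μ) l - m =
      (∫ x, Real.exp ⟪l, R x⟫ ∂μ)⁻¹ • ∫ x, Real.exp ⟪l, R x⟫ • (R x - m) ∂μ := by
  rw [(hasGradientAt_logPartition hR hRC l).gradient, integral_exp_inner_smul_sub hR hRC,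
    smul_sub, inv_smul_smul₀ (integral_exp_inner_pos hR hRC l).ne']

theorem isMultiplier_iff_gradient [IsProbabilityMeasure μ] (hR : StronglyMeasurable R)
    (hRC : ∀ x, ‖R x‖ ≤ C) :
    IsMultiplier R m μ l ↔ gradient (fun l => logPartition R l μ) l = m :=
  ⟨fun h => HasGradientAt.gradient h, fun h => h ▸
    (hasGradientAt_logPartition hR hRC l).differentiableAt.hasGradientAt⟩

/-- Clearing the normalising constant leaves an equation linear in `μ`, which is what makes segments
of measures tractable. -/
theorem isMultiplier_iff [IsProbabilityMeasure μ] (hR : StronglyMeasurable R)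
    (hRC : ∀ x, ‖R x‖ ≤ C) :
    IsMultiplier R m μ l ↔ ∫ x, Real.exp ⟪l, R x⟫ • (R x - m) ∂μ = 0 := by
  rw [isMultiplier_iff_gradient hR hRC, ← sub_eq_zero, gradient_logPartition_sub hR hRC]
  simp [(integral_exp_inner_pos hR hRC l).ne']

/-- Centring `R` at `m` only multiplies by `exp (-⟪l, m⟫)`, and turns the multiplier equation into
criticality for the convex function `Z`. -/
theorem isMultiplier_iff_critical [IsProbabilityMeasure μ] (hR : StronglyMeasurable R)
    (hRC : ∀ x, ‖R x‖ ≤ C) :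
    IsMultiplier R m μ l ↔ ∫ x, Real.exp ⟪l, R x - m⟫ • (R x - m) ∂μ = 0 := by
  rw [isMultiplier_iff hR hRC, integral_exp_inner_sub_smul]
  simp [Real.exp_ne_zero]

theorem isMultiplier_multiplier (h : IsMultiplier R m μ l) :
    IsMultiplier R m μ (multiplier R m μ) := by
  have h' : ∃ l, IsMultiplier R m μ l := ⟨l, h⟩
  rw [multiplier, dif_pos h']
  exact h'.choose_spec

theorem isMultiplier_zero [IsProbabilityMeasure μ] (hR : StronglyMeasurable R)
    (hRC : ∀ x, ‖R x‖ ≤ C) : IsMultiplier R (∫ x, R x ∂μ) μ 0 := by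
  rw [isMultiplier_iff_gradient hR hRC, (hasGradientAt_logPartition hR hRC 0).gradient]
  simp

theorem Spread.isMultiplier_multiplier [IsProbabilityMeasure μ]
    (h : Spread (fun x => R x - m) μ) (hR : StronglyMeasurable R) (hRC : ∀ x, ‖R x‖ ≤ C) :
    IsMultiplier R m μ (multiplier R m μ) := by
  obtain ⟨l, hl⟩ := h.exists_critical (hR.sub stronglyMeasurable_const).aestronglyMeasurable
    (norm_sub_le_of_norm_le hRC m)
  exact EntropyMatching.isMultiplier_multiplier ((isMultiplier_iff_critical hR hRC).2 hl)

theorem Spread.eq_multiplier [IsProbabilityMeasure μ]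
    (h : Spread (fun x => R x - m) μ) (hR : StronglyMeasurable R) (hRC : ∀ x, ‖R x‖ ≤ C)
    (hl : IsMultiplier R m μ l) : l = multiplier R m μ :=
  h.critical_unique (hR.sub stronglyMeasurable_const).aestronglyMeasurable
    (norm_sub_le_of_norm_le hRC m)
    ((isMultiplier_iff_critical hR hRC).1 (h.isMultiplier_multiplier hR hRC))
    ((isMultiplier_iff_critical hR hRC).1 hl)

theorem isProbabilityMeasure_expFamily [IsProbabilityMeasure μ] (hR : StronglyMeasurable R)
    (hRC : ∀ x, ‖R x‖ ≤ C) (l : EuclideanSpace ℝ (Fin L)) :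
    IsProbabilityMeasure (expFamily R l μ) :=
  isProbabilityMeasure_tilted (integrable_exp_inner hR.aestronglyMeasurable hRC l)

theorem expFamily_absolutelyContinuous (R : Ω → EuclideanSpace ℝ (Fin L))
    (l : EuclideanSpace ℝ (Fin L)) (μ : Measure Ω) : expFamily R l μ ≪ μ :=
  tilted_absolutelyContinuous μ _

theorem integral_expFamily {F : Type*} [NormedAddCommGroup F] [NormedSpace ℝ F] (g : Ω → F) :
    ∫ x, g x ∂(expFamily R l μ) =
      (∫ x, Real.exp ⟪l, R x⟫ ∂μ)⁻¹ • ∫ x, Real.exp ⟪l, R x⟫ • g x ∂μ := by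
  rw [expFamily, integral_tilted, ← integral_smul]
  simp_rw [div_eq_inv_mul, mul_smul]

theorem IsMultiplier.integral_expFamily_eq [IsProbabilityMeasure μ] (hl : IsMultiplier R m μ l)
    (hR : StronglyMeasurable R) (hRC : ∀ x, ‖R x‖ ≤ C) :
    ∫ x, R x ∂(expFamily R l μ) = m := by
  rw [integral_expFamily, ← (hasGradientAt_logPartition hR hRC l).gradient]
  exact HasGradientAt.gradient hl

theorem klDiv_eq_ofReal_integral_llr [IsProbabilityMeasure μ] [IsProbabilityMeasure ν]
    (hac : ν ≪ μ) (hint : Integrable (llr ν μ) ν) :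
    klDiv ν μ = ENNReal.ofReal (∫ x, llr ν μ x ∂ν) := by
  rw [klDiv_of_ac_of_integrable hac hint]
  simp

theorem integral_llr_nonneg [IsProbabilityMeasure μ] [IsProbabilityMeasure ν]
    (hac : ν ≪ μ) (hint : Integrable (llr ν μ) ν) : 0 ≤ ∫ x, llr ν μ x ∂ν := by
  simpa using integral_llr_add_sub_measure_univ_nonneg hac hint

theorem integrable_inner_of_norm_le [IsFiniteMeasure μ] (hR : StronglyMeasurable R)
    (hRC : ∀ x, ‖R x‖ ≤ C) (l : EuclideanSpace ℝ (Fin L)) :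
    Integrable (fun x => ⟪l, R x⟫) μ :=
  (Integrable.of_bound hR.aestronglyMeasurable C (ae_of_all _ hRC)).const_inner l

theorem integral_inner_eq [IsFiniteMeasure μ] (hR : StronglyMeasurable R)
    (hRC : ∀ x, ‖R x‖ ≤ C) (l : EuclideanSpace ℝ (Fin L)) :
    ∫ x, ⟪l, R x⟫ ∂μ = ⟪l, ∫ x, R x ∂μ⟫ :=
  integral_inner (Integrable.of_bound hR.aestronglyMeasurable C (ae_of_all _ hRC)) l

theorem llr_expFamily_ae_eq [IsProbabilityMeasure μ] (hR : StronglyMeasurable R)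
    (hRC : ∀ x, ‖R x‖ ≤ C) (l : EuclideanSpace ℝ (Fin L)) :
    llr (expFamily R l μ) μ =ᵐ[expFamily R l μ] fun x => ⟪l, R x⟫ - logPartition R l μ :=
  (expFamily_absolutelyContinuous R l μ).ae_le
    (log_rnDeriv_tilted_left_self (integrable_exp_inner hR.aestronglyMeasurable hRC l))

theorem integrable_llr_expFamily [IsProbabilityMeasure μ] (hR : StronglyMeasurable R)
    (hRC : ∀ x, ‖R x‖ ≤ C) (l : EuclideanSpace ℝ (Fin L)) :
    Integrable (llr (expFamily R l μ) μ) (expFamily R l μ) := by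
  have := isProbabilityMeasure_expFamily (μ := μ) hR hRC l
  rw [integrable_congr (llr_expFamily_ae_eq hR hRC l)]
  exact (integrable_inner_of_norm_le hR hRC l).sub (integrable_const _)

theorem IsMultiplier.integral_llr_expFamily [IsProbabilityMeasure μ] (hl : IsMultiplier R m μ l)
    (hR : StronglyMeasurable R) (hRC : ∀ x, ‖R x‖ ≤ C) :
    ∫ x, llr (expFamily R l μ) μ x ∂(expFamily R l μ) = ⟪l, m⟫ - logPartition R l μ := by
  have := isProbabilityMeasure_expFamily (μ := μ) hR hRC l
  rw [integral_congr_ae (llr_expFamily_ae_eq hR hRC l),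
    integral_sub (integrable_inner_of_norm_le hR hRC l) (integrable_const _),
    integral_inner_eq hR hRC, hl.integral_expFamily_eq hR hRC]
  simp

theorem IsMultiplier.klDiv_expFamily [IsProbabilityMeasure μ] (hl : IsMultiplier R m μ l)
    (hR : StronglyMeasurable R) (hRC : ∀ x, ‖R x‖ ≤ C) :
    klDiv (expFamily R l μ) μ = ENNReal.ofReal (⟪l, m⟫ - logPartition R l μ) := by
  have := isProbabilityMeasure_expFamily (μ := μ) hR hRC l
  rw [klDiv_eq_ofReal_integral_llr (expFamily_absolutelyContinuous R l μ)
    (integrable_llr_expFamily hR hRC l), hl.integral_llr_expFamily hR hRC]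

/-- The Pythagorean identity for the relative entropy. -/
theorem IsMultiplier.klDiv_eq_add [IsProbabilityMeasure μ] [IsProbabilityMeasure ν]
    (hl : IsMultiplier R m μ l) (hR : StronglyMeasurable R) (hRC : ∀ x, ‖R x‖ ≤ C)
    (hac : ν ≪ μ) (hν : ∫ x, R x ∂ν = m) :
    klDiv ν μ = klDiv ν (expFamily R l μ) + klDiv (expFamily R l μ) μ := by
  have := isProbabilityMeasure_expFamily (μ := μ) hR hRC l
  have hexp := integrable_exp_inner (μ := μ) hR.aestronglyMeasurable hRC l
  have hac' : ν ≪ expFamily R l μ := hac.trans (absolutelyContinuous_tilted hexp)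
  have hinner : Integrable (fun x => ⟪l, R x⟫) ν := integrable_inner_of_norm_le hR hRC l
  by_cases hint : Integrable (llr ν μ) ν
  · have hint' : Integrable (llr ν (expFamily R l μ)) ν :=
      integrable_llr_tilted_right hac hinner hint hexp
    rw [klDiv_eq_ofReal_integral_llr hac hint, klDiv_eq_ofReal_integral_llr hac' hint',
      klDiv_eq_ofReal_integral_llr (expFamily_absolutelyContinuous R l μ)
        (integrable_llr_expFamily hR hRC l),
      ← ENNReal.ofReal_add (integral_llr_nonneg hac' hint')
        (integral_llr_nonneg (expFamily_absolutelyContinuous R l μ) (integrable_llr_expFamily hR hRC l)),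
      hl.integral_llr_expFamily hR hRC]
    congr 1
    -- The two log-likelihood ratios differ by `⟪l, R⟫ - A`, whose `ν`-integral is `⟪l, m⟫ - A`
    -- because `ν` has moment `m`.
    have h := integral_llr_tilted_right hac hinner hexp hint
    rw [integral_inner_eq hR hRC, hν] at h
    rw [expFamily, h, logPartition]
    ring
  -- That difference is bounded, so integrability fails for both ratios at once and both divergences
  -- are `⊤`.
  · have hint' : ¬ Integrable (llr ν (expFamily R l μ)) ν := fun h => hint <| by
      have h1 := (integrable_congr (llr_tilted_right hac hexp)).1 h
      have h2 := h1.sub ((hinner.neg.add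
        (integrable_const (Real.log (∫ z, Real.exp ⟪l, R z⟫ ∂μ)))))
      refine h2.congr (ae_of_all _ fun x => ?_)
      simp
    rw [klDiv_of_not_integrable hint, klDiv_of_not_integrable hint', top_add]

end Multiplier

/-! ### The tilted measure as unique entropy minimiser. -/

section Matching

variable {Ω : Type*} [MeasurableSpace Ω] {L : ℕ} {R : Ω → EuclideanSpace ℝ (Fin L)}
  {μ : ProbabilityMeasure Ω} {m l : EuclideanSpace ℝ (Fin L)} {C : ℝ}

theorem IsMultiplier.klDiv_expFamily_le (hl : IsMultiplier R m μ l) (hR : StronglyMeasurable R)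
    (hRC : ∀ x, ‖R x‖ ≤ C) (ρ : ProbabilityMeasure Ω) (hρ : ∫ x, R x ∂(ρ : Measure Ω) = m) :
    klDiv (expFamily R l μ) (μ : Measure Ω) ≤ klDiv (ρ : Measure Ω) (μ : Measure Ω) := by
  by_cases hac : (ρ : Measure Ω) ≪ (μ : Measure Ω)
  · rw [hl.klDiv_eq_add hR hRC hac hρ]
    exact le_add_self
  · rw [klDiv_of_not_ac hac]
    exact le_top

/-- Minimality and the Pythagorean identity force the divergence from `ρ` to the tilted measure to
vanish, once the finite term is cancelled. As `l` is any multiplier, the choice among several is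
immaterial. -/
theorem IsMultiplier.coe_eq_expFamily (hl : IsMultiplier R m μ l) (hR : StronglyMeasurable R)
    (hRC : ∀ x, ‖R x‖ ≤ C) {ρ : ProbabilityMeasure Ω} (hρ : IsMatching R m μ ρ) :
    (ρ : Measure Ω) = expFamily R l μ := by
  have hp := isProbabilityMeasure_expFamily (μ := (μ : Measure Ω)) hR hRC l
  have hle := hρ.2 ⟨_, hp⟩ (hl.integral_expFamily_eq hR hRC)
  have hfin : klDiv (expFamily R l μ) (μ : Measure Ω) ≠ ⊤ := by
    rw [hl.klDiv_expFamily hR hRC]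
    exact ENNReal.ofReal_ne_top
  have hac : (ρ : Measure Ω) ≪ (μ : Measure Ω) := by
    by_contra h
    rw [klDiv_of_not_ac h, top_le_iff] at hle
    exact hfin hle
  rw [hl.klDiv_eq_add hR hRC hac hρ.1] at hle
  have h0 : klDiv (ρ : Measure Ω) (expFamily R l μ) ≤ 0 := by
    refine (ENNReal.add_le_add_iff_right hfin).1 ?_
    rw [zero_add]
    exact hle
  exact klDiv_eq_zero_iff.1 (le_antisymm h0 zero_le)

theorem IsMultiplier.isMatching_matching (hl : IsMultiplier R m μ l) (hR : StronglyMeasurable R)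
    (hRC : ∀ x, ‖R x‖ ≤ C) : IsMatching R m μ (matching R m μ) := by
  have h : ∃ ν, IsMatching R m μ ν :=
    ⟨⟨_, isProbabilityMeasure_expFamily hR hRC l⟩, hl.integral_expFamily_eq hR hRC,
      fun ρ hρ => hl.klDiv_expFamily_le hR hRC ρ hρ⟩
  rw [matching, dif_pos h]
  exact h.choose_spec

theorem IsMultiplier.coe_matching (hl : IsMultiplier R m μ l) (hR : StronglyMeasurable R)
    (hRC : ∀ x, ‖R x‖ ≤ C) : (matching R m μ : Measure Ω) = expFamily R l μ :=
  hl.coe_eq_expFamily hR hRC (hl.isMatching_matching hR hRC)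

end Matching

/-! ### Interior moments imply spread. -/

section Domain

variable {Ω : Type*} [TopologicalSpace Ω] [MeasurableSpace Ω] {L : ℕ}
  {R : Ω → EuclideanSpace ℝ (Fin L)} {μ : Measure Ω} {m : EuclideanSpace ℝ (Fin L)} {C : ℝ}

/-- If `⟪u, R - m⟫ ≤ 0` a.e., continuity extends this to the whole support, hence to every `ν`
carried by it. But `m + t • u` is the moment of such a `ν` for small `t > 0`, giving `t * ‖u‖ ^ 2 ≤
0`. -/
theorem spread_of_mem_interior_momentSpace (hR : Continuous R) [OpensMeasurableSpace Ω]
    (hRC : ∀ x, ‖R x‖ ≤ C)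
    (hm : m ∈ interior (momentSpace μ.support R)) : Spread (fun x => R x - m) μ := by
  intro u hu hle
  have hsupp : ∀ x ∈ μ.support, ⟪u, R x - m⟫ ≤ 0 := fun x hx =>
    Measure.support_subset_of_isClosed
      (isClosed_le (by fun_prop : Continuous fun x => ⟪u, R x - m⟫) continuous_const) hle hx
  have hcont : Tendsto (fun t : ℝ => m + t • u) (𝓝 0) (𝓝 m) := by
    have : Continuous fun t : ℝ => m + t • u := by fun_prop
    simpa using this.tendsto 0
  have hev : ∀ᶠ t : ℝ in 𝓝[>] 0, m + t • u ∈ momentSpace μ.support R :=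
    (hcont.eventually (mem_interior_iff_mem_nhds.1 hm)).filter_mono nhdsWithin_le_nhds
  obtain ⟨t, ⟨ν, hν, hνm⟩, ht⟩ := (hev.and self_mem_nhdsWithin).exists
  replace ht : 0 < t := ht
  have hi : Integrable R (ν : Measure Ω) :=
    Integrable.of_bound hR.stronglyMeasurable.aestronglyMeasurable C (ae_of_all _ hRC)
  have h1 : ∫ x, ⟪u, R x - m⟫ ∂(ν : Measure Ω) ≤ 0 := by
    refine integral_nonpos_of_ae ?_
    filter_upwards [show ∀ᵐ x ∂(ν : Measure Ω), x ∈ μ.support from hν] with x hx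
    exact hsupp x hx
  have hsub : Integrable (fun x => R x - m) (ν : Measure Ω) := hi.sub (integrable_const m)
  rw [integral_inner hsub, integral_sub hi (integrable_const m), hνm] at h1
  have h2 : 0 < ⟪u, u⟫ := real_inner_self_pos.2 hu
  simp only [integral_const, probReal_univ, one_smul, add_sub_cancel_left, inner_smul_right] at h1
  nlinarith

end Domain

theorem abs_exp_sub_one_le_exp_abs_sub_one (t : ℝ) : |Real.exp t - 1| ≤ Real.exp |t| - 1 := by
  rcases le_total 0 t with h | h
  · rw [abs_of_nonneg h, abs_of_nonneg (by linarith [Real.one_le_exp h])]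
  · rw [abs_of_nonpos h, abs_of_nonpos (by linarith [Real.exp_le_one_iff.2 h])]
    linarith [Real.add_one_le_exp t, Real.add_one_le_exp (-t)]

/-! ### Joint continuity in the moment and the prior. -/

section Continuity

variable {Ω : Type*} [TopologicalSpace Ω] [MeasurableSpace Ω] [OpensMeasurableSpace Ω] {L : ℕ}
  {R : Ω → EuclideanSpace ℝ (Fin L)} {C : ℝ}

open BoundedContinuousFunction in
theorem continuous_integral_exp_inner_mul (hR : Continuous R) (hRC : ∀ x, ‖R x‖ ≤ C)
    (g : Ω →ᵇ ℝ) :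
    Continuous fun p : EuclideanSpace ℝ (Fin L) × ProbabilityMeasure Ω =>
      ∫ x, Real.exp ⟪p.1, R x⟫ * g x ∂(p.2 : Measure Ω) := by
  have hR' : ∀ μ : Measure Ω, AEStronglyMeasurable R μ := fun μ =>
    hR.stronglyMeasurable.aestronglyMeasurable
  have hint : ∀ (l : EuclideanSpace ℝ (Fin L)) (μ : ProbabilityMeasure Ω),
      Integrable (fun x => Real.exp ⟪l, R x⟫ * g x) (μ : Measure Ω) := fun l μ =>
    integrable_exp_inner_smul (hR' μ) hRC g.continuous.aestronglyMeasurable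
      g.norm_coe_le_norm l
  refine continuous_iff_continuousAt.2 fun ⟨l₀, μ₀⟩ => ?_
  let f : Ω →ᵇ ℝ := BoundedContinuousFunction.ofNormedAddCommGroup
    (fun x => Real.exp ⟪l₀, R x⟫ * g x) (by fun_prop) (Real.exp (‖l₀‖ * C) * ‖g‖) fun x => by
      rw [norm_mul, Real.norm_of_nonneg (Real.exp_nonneg _)]
      exact mul_le_mul (exp_inner_le (hRC x) le_rfl) (g.norm_coe_le_norm x) (norm_nonneg _)
        (Real.exp_nonneg _)
  have h1 : Tendsto (fun p : EuclideanSpace ℝ (Fin L) × ProbabilityMeasure Ω =>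
      ∫ x, f x ∂(p.2 : Measure Ω)) (𝓝 (l₀, μ₀)) (𝓝 (∫ x, f x ∂(μ₀ : Measure Ω))) :=
    ProbabilityMeasure.tendsto_iff_forall_integral_tendsto.1 (continuous_snd.tendsto (l₀, μ₀)) f
  -- Weak convergence handles the integrand frozen at `l₀`; the error from moving `l` is small in
  -- sup norm, hence uniformly over probability measures.
  have h2 : Tendsto (fun p : EuclideanSpace ℝ (Fin L) × ProbabilityMeasure Ω =>
      ∫ x, (Real.exp ⟪p.1, R x⟫ * g x - Real.exp ⟪l₀, R x⟫ * g x) ∂(p.2 : Measure Ω))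
      (𝓝 (l₀, μ₀)) (𝓝 0) := by
    have hlim : Tendsto (fun p : EuclideanSpace ℝ (Fin L) × ProbabilityMeasure Ω =>
        Real.exp (‖l₀‖ * C) * (Real.exp (‖p.1 - l₀‖ * C) - 1) * ‖g‖) (𝓝 (l₀, μ₀)) (𝓝 0) := by
      have hc : Continuous fun p : EuclideanSpace ℝ (Fin L) × ProbabilityMeasure Ω =>
        Real.exp (‖l₀‖ * C) * (Real.exp (‖p.1 - l₀‖ * C) - 1) * ‖g‖ := by fun_prop
      simpa using hc.tendsto (l₀, μ₀)
    refine squeeze_zero_norm (fun p => ?_) hlim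
    refine (norm_integral_le_of_norm_le_const (C := Real.exp (‖l₀‖ * C) *
      (Real.exp (‖p.1 - l₀‖ * C) - 1) * ‖g‖) (ae_of_all _ fun x => ?_)).trans (by simp)
    have hx : Real.exp ⟪p.1, R x⟫ * g x - Real.exp ⟪l₀, R x⟫ * g x =
        Real.exp ⟪l₀, R x⟫ * (Real.exp ⟪p.1 - l₀, R x⟫ - 1) * g x := by
      have : Real.exp ⟪p.1, R x⟫ = Real.exp ⟪l₀, R x⟫ * Real.exp ⟪p.1 - l₀, R x⟫ := by
        rw [← Real.exp_add, inner_sub_left]; congr 1; ring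
      rw [this]; ring
    have h3 : |Real.exp ⟪p.1 - l₀, R x⟫ - 1| ≤ Real.exp (‖p.1 - l₀‖ * C) - 1 :=
      (abs_exp_sub_one_le_exp_abs_sub_one _).trans (sub_le_sub_right (Real.exp_le_exp.2
        ((abs_real_inner_le_norm _ _).trans
          (mul_le_mul_of_nonneg_left (hRC x) (norm_nonneg _)))) _)
    rw [hx, norm_mul, norm_mul, Real.norm_of_nonneg (Real.exp_nonneg _), Real.norm_eq_abs]
    exact mul_le_mul (mul_le_mul (exp_inner_le (hRC x) le_rfl) h3 (abs_nonneg _)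
      (Real.exp_nonneg _)) (g.norm_coe_le_norm x) (norm_nonneg _)
      (mul_nonneg (Real.exp_nonneg _) ((abs_nonneg _).trans h3))
  have h4 := h2.add h1
  rw [zero_add] at h4
  refine h4.congr fun p => ?_
  rw [integral_sub (hint _ _) (hint _ _)]
  exact sub_add_cancel _ _

theorem continuous_integral_exp_inner_prod (hR : Continuous R) (hRC : ∀ x, ‖R x‖ ≤ C) :
    Continuous fun p : EuclideanSpace ℝ (Fin L) × ProbabilityMeasure Ω =>
      ∫ x, Real.exp ⟪p.1, R x⟫ ∂(p.2 : Measure Ω) := by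
  simpa using continuous_integral_exp_inner_mul hR hRC (BoundedContinuousFunction.const Ω (1 : ℝ))

variable {s : Set (EuclideanSpace ℝ (Fin L) × ProbabilityMeasure Ω)}
  {p : EuclideanSpace ℝ (Fin L) × ProbabilityMeasure Ω}

/-- Only the limit point needs a strict minimiser. At other points of `s` any chosen minimiser will
do, so degenerate pairs are allowed there. -/
theorem Spread.continuousWithinAt_multiplier (hR : Continuous R) (hRC : ∀ x, ‖R x‖ ≤ C)
    (hp : Spread (fun x => R x - p.1) (p.2 : Measure Ω))
    (hs : ∀ q ∈ s, IsMultiplier R q.1 q.2 (multiplier R q.1 q.2)) :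
    ContinuousWithinAt (fun q : EuclideanSpace ℝ (Fin L) × ProbabilityMeasure Ω =>
      multiplier R q.1 q.2) s p := by
  have hm := hR.stronglyMeasurable
  have hm' : ∀ (m : EuclideanSpace ℝ (Fin L)) (μ : Measure Ω),
      AEStronglyMeasurable (fun x => R x - m) μ :=
    fun m μ => (hm.sub stronglyMeasurable_const).aestronglyMeasurable
  refine continuousWithinAt_of_convex_min
    (Z := fun q l => ∫ x, Real.exp ⟪l, R x - q.1⟫ ∂(q.2 : Measure Ω)) ?_ ?_ ?_ ?_
  · simp_rw [integral_exp_inner_sub]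
    refine Continuous.mul (by fun_prop) ?_
    exact (continuous_integral_exp_inner_prod hR hRC).comp
      (continuous_snd.prodMk (continuous_snd.comp continuous_fst))
  · exact fun q _ => convexOn_integral_exp_inner (hm' _ _) (norm_sub_le_of_norm_le hRC _)
  · exact fun q hq => integral_exp_inner_le_of_critical (hm' _ _) (norm_sub_le_of_norm_le hRC _)
      ((isMultiplier_iff_critical hm hRC).1 (hs q hq))
  · exact fun l hl => hp.integral_exp_inner_lt (hm' _ _) (norm_sub_le_of_norm_le hRC _)
      ((isMultiplier_iff_critical hm hRC).1 (hp.isMultiplier_multiplier hm hRC)) hl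

theorem Spread.continuousWithinAt_matching (hR : Continuous R) (hRC : ∀ x, ‖R x‖ ≤ C)
    (hp : Spread (fun x => R x - p.1) (p.2 : Measure Ω))
    (hs : ∀ q ∈ s, IsMultiplier R q.1 q.2 (multiplier R q.1 q.2)) :
    ContinuousWithinAt (fun q : EuclideanSpace ℝ (Fin L) × ProbabilityMeasure Ω =>
      matching R q.1 q.2) s p := by
  have hm := hR.stronglyMeasurable
  have hpair := (hp.continuousWithinAt_multiplier hR hRC hs).prodMk
    (continuous_snd.continuousWithinAt (s := s) (x := p))
  have hmat : ∀ q : EuclideanSpace ℝ (Fin L) × ProbabilityMeasure Ω,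
      IsMultiplier R q.1 q.2 (multiplier R q.1 q.2) → ∀ f : Ω → ℝ,
      ∫ x, f x ∂(matching R q.1 q.2 : Measure Ω) =
        (∫ x, Real.exp ⟪multiplier R q.1 q.2, R x⟫ ∂(q.2 : Measure Ω))⁻¹ *
          ∫ x, Real.exp ⟪multiplier R q.1 q.2, R x⟫ * f x ∂(q.2 : Measure Ω) := fun q hq f => by
    rw [hq.coe_matching hm hRC, integral_expFamily]
    rfl
  refine ProbabilityMeasure.tendsto_iff_forall_integral_tendsto.2 fun f => ?_
  rw [hmat p (hp.isMultiplier_multiplier hm hRC)]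
  have h1 := (continuous_integral_exp_inner_prod hR hRC).continuousAt.comp_continuousWithinAt hpair
  have h2 := (continuous_integral_exp_inner_mul hR hRC f).continuousAt.comp_continuousWithinAt hpair
  refine ((h1.inv₀ (integral_exp_inner_pos hm hRC _).ne').mul h2).tendsto.congr' ?_
  filter_upwards [self_mem_nhdsWithin] with q hq
  exact (hmat q (hs q hq) f).symm

theorem Spread.continuousWithinAt_klDiv_matching (hR : Continuous R) (hRC : ∀ x, ‖R x‖ ≤ C)
    (hp : Spread (fun x => R x - p.1) (p.2 : Measure Ω))
    (hs : ∀ q ∈ s, IsMultiplier R q.1 q.2 (multiplier R q.1 q.2)) :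
    ContinuousWithinAt (fun q : EuclideanSpace ℝ (Fin L) × ProbabilityMeasure Ω =>
      klDiv (matching R q.1 q.2 : Measure Ω) (q.2 : Measure Ω)) s p := by
  have hm := hR.stronglyMeasurable
  have hl := hp.continuousWithinAt_multiplier hR hRC hs
  have hpair := hl.prodMk (continuous_snd.continuousWithinAt (s := s) (x := p))
  have hkl : ∀ q : EuclideanSpace ℝ (Fin L) × ProbabilityMeasure Ω,
      IsMultiplier R q.1 q.2 (multiplier R q.1 q.2) →
      klDiv (matching R q.1 q.2 : Measure Ω) (q.2 : Measure Ω) =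
        ENNReal.ofReal (⟪multiplier R q.1 q.2, q.1⟫ -
          Real.log (∫ x, Real.exp ⟪multiplier R q.1 q.2, R x⟫ ∂(q.2 : Measure Ω))) :=
    fun q hq => by
      rw [hq.coe_matching hm hRC, hq.klDiv_expFamily hm hRC]
      rfl
  have h1 := (continuous_integral_exp_inner_prod hR hRC).continuousAt.comp_continuousWithinAt hpair
  refine ContinuousWithinAt.congr_of_eventuallyEq ?_
    (eventually_nhdsWithin_of_forall fun q hq => hkl q (hs q hq))
    (hkl p (hp.isMultiplier_multiplier hm hRC))
  exact ENNReal.continuous_ofReal.continuousAt.comp_continuousWithinAt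
    ((hl.inner continuous_fst.continuousWithinAt).sub
      (h1.log (integral_exp_inner_pos hm hRC _).ne'))

end Continuity

/-! ### The Hessian of the log-partition function. -/

section Hessian

variable {Ω : Type*} [MeasurableSpace Ω] {L : ℕ} {R : Ω → EuclideanSpace ℝ (Fin L)}
  {μ : Measure Ω} {m l : EuclideanSpace ℝ (Fin L)} {C : ℝ}

/-- Write the gradient as `m + Z⁻¹ • J` with `J` the gradient of `Z`. Since `J` vanishes at a
multiplier, the term differentiating `Z⁻¹` drops out and the covariance remains. -/
theorem IsMultiplier.hasFDerivAt_gradient_logPartition [IsProbabilityMeasure μ]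
    (hl : IsMultiplier R m μ l) (hR : StronglyMeasurable R) (hRC : ∀ x, ‖R x‖ ≤ C) :
    HasFDerivAt (fun l => gradient (fun l => logPartition R l μ) l)
      ((∫ x, Real.exp ⟪l, R x - m⟫ ∂μ)⁻¹ •
        ∫ x, Real.exp ⟪l, R x - m⟫ • (innerSL ℝ (R x - m)).smulRight (R x - m) ∂μ) l := by
  have hY : StronglyMeasurable fun x => R x - m := hR.sub stronglyMeasurable_const
  have hYC := norm_sub_le_of_norm_le hRC m
  have hgrad : ∀ l', gradient (fun l => logPartition R l μ) l' =
      m + (∫ x, Real.exp ⟪l', R x - m⟫ ∂μ)⁻¹ •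
        ∫ x, Real.exp ⟪l', R x - m⟫ • (R x - m) ∂μ := fun l' => by
    rw [← sub_eq_iff_eq_add', gradient_logPartition_sub hR hRC, integral_exp_inner_sub,
      integral_exp_inner_sub_smul, smul_smul]
    congr 1
    field_simp [Real.exp_ne_zero]
  have hZ := (hasGradientAt_integral_exp_inner (μ := μ) hY.aestronglyMeasurable hYC l)
  rw [hasGradientAt_iff_hasFDerivAt] at hZ
  have hJ := hasFDerivAt_integral_exp_inner_smul (μ := μ) hY.aestronglyMeasurable hYC
    hY.aestronglyMeasurable hYC l
  have h := (((hasDerivAt_inv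
    (integral_exp_inner_pos hY hYC l).ne').comp_hasFDerivAt l hZ).smul hJ).const_add m
  simp_rw [hgrad]
  refine h.congr_fderiv ?_
  rw [(isMultiplier_iff_critical hR hRC).1 hl]
  simp

theorem IsMultiplier.hasFDerivAt_hessLogPartition [IsProbabilityMeasure μ]
    (hl : IsMultiplier R m μ l) (hR : StronglyMeasurable R) (hRC : ∀ x, ‖R x‖ ≤ C) :
    HasFDerivAt (fun l => gradient (fun l => logPartition R l μ) l)
      (hessLogPartition R l μ) l :=
  (hl.hasFDerivAt_gradient_logPartition hR hRC).differentiableAt.hasFDerivAt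

/-- A kernel vector `u` makes the weighted integral of `⟪u, R - m⟫ ^ 2` vanish, so `u = 0` by
`Spread`; an injective endomorphism in finite dimension is invertible. -/
theorem Spread.isInvertible_hessLogPartition [IsProbabilityMeasure μ]
    (h : Spread (fun x => R x - m) μ) (hl : IsMultiplier R m μ l) (hR : StronglyMeasurable R)
    (hRC : ∀ x, ‖R x‖ ≤ C) : (hessLogPartition R l μ).IsInvertible := by
  have hY : AEStronglyMeasurable (fun x => R x - m) μ :=
    (hR.sub stronglyMeasurable_const).aestronglyMeasurable
  have hYC := norm_sub_le_of_norm_le hRC m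
  have hmeas : AEStronglyMeasurable
      (fun x => (innerSL ℝ (R x - m)).smulRight (R x - m)) μ := by
    have h : Continuous fun y : EuclideanSpace ℝ (Fin L) => (innerSL ℝ y).smulRight y := by
      fun_prop
    exact h.comp_aestronglyMeasurable hY
  have hint := integrable_exp_inner_smul (D := (C + ‖m‖) * (C + ‖m‖)) hY hYC hmeas (fun x => by
    rw [ContinuousLinearMap.norm_smulRight_apply, innerSL_apply_norm]
    exact mul_le_mul (hYC x) (hYC x) (norm_nonneg _) ((norm_nonneg _).trans (hYC x))) l
  have hinj : Function.Injective (hessLogPartition R l μ) := by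
    refine (injective_iff_map_eq_zero _).2 fun u hu => h.eq_zero ?_
    rw [hessLogPartition, (hl.hasFDerivAt_gradient_logPartition hR hRC).fderiv,
      smul_apply, smul_eq_zero] at hu
    have hpos : 0 < ∫ x, Real.exp ⟪l, R x - m⟫ ∂μ :=
      integral_exp_inner_pos (hR.sub stronglyMeasurable_const) hYC l
    replace hu := hu.resolve_left (inv_ne_zero hpos.ne')
    rw [ContinuousLinearMap.integral_apply hint] at hu
    have hint' := hint.apply_continuousLinearMap u
    have hsq : ∀ x, ⟪u, (Real.exp ⟪l, R x - m⟫ •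
        (innerSL ℝ (R x - m)).smulRight (R x - m)) u⟫ =
        Real.exp ⟪l, R x - m⟫ * ⟪u, R x - m⟫ ^ 2 := fun x => by
      simp only [smul_apply, ContinuousLinearMap.smulRight_apply,
        innerSL_apply_apply, inner_smul_right, real_inner_comm u]
      ring
    have h0 := integral_inner (𝕜 := ℝ) hint' u
    rw [hu, inner_zero_right] at h0
    have hint2 := hint'.const_inner (𝕜 := ℝ) u
    simp_rw [hsq] at h0 hint2
    filter_upwards [(integral_eq_zero_iff_of_nonneg (fun x => by positivity) hint2).1 h0] with x hx
    simpa [Real.exp_ne_zero] using hx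
  exact ⟨(LinearEquiv.ofInjectiveEndo _ hinj).toContinuousLinearEquiv, by ext; rfl⟩

end Hessian

/-! ### Derivative of the multipliers in the moment. -/

section Moments

variable {Ω : Type*} [TopologicalSpace Ω] [MeasurableSpace Ω] [OpensMeasurableSpace Ω] {L : ℕ}
  {R : Ω → EuclideanSpace ℝ (Fin L)} {μ : ProbabilityMeasure Ω} {m : EuclideanSpace ℝ (Fin L)}
  {C : ℝ}

/-- The gradient map undoes the multiplier map near `m`. Continuity of the latter and invertibility
of the Hessian at the single point `m` then suffice for the inverse derivative. -/
theorem hasFDerivAt_multiplier (hR : Continuous R) (hRC : ∀ x, ‖R x‖ ≤ C)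
    (h : ∀ᶠ m' in 𝓝 m, Spread (fun x => R x - m') (μ : Measure Ω)) :
    HasFDerivAt (fun m' => multiplier R m' (μ : Measure Ω))
      (hessLogPartition R (multiplier R m μ) μ).inverse m := by
  have hm := hR.stronglyMeasurable
  have hcont : ContinuousAt (fun m' => multiplier R m' (μ : Measure Ω)) m := by
    have h1 := h.self_of_nhds.continuousWithinAt_multiplier (p := (m, μ))
      (s := {q | Spread (fun x => R x - q.1) (q.2 : Measure Ω)}) hR hRC
      fun q (hq : Spread (fun x => R x - q.1) (q.2 : Measure Ω)) =>
        hq.isMultiplier_multiplier hm hRC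
    have h2 : Tendsto (fun m' => (m', μ)) (𝓝 m)
        (𝓝[{q | Spread (fun x => R x - q.1) (q.2 : Measure Ω)}] (m, μ)) :=
      tendsto_nhdsWithin_iff.2
        ⟨(continuous_id.prodMk continuous_const).tendsto m, h⟩
    exact h1.tendsto.comp h2
  have hl := h.self_of_nhds.isMultiplier_multiplier hm hRC
  obtain ⟨A, hA⟩ := h.self_of_nhds.isInvertible_hessLogPartition hl hm hRC
  have hder := hl.hasFDerivAt_hessLogPartition hm hRC
  rw [← hA] at hder ⊢
  rw [ContinuousLinearMap.inverse_equiv]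
  exact HasFDerivAt.of_local_left_inverse hcont hder (h.mono fun m' hm' =>
    HasGradientAt.gradient (hm'.isMultiplier_multiplier hm hRC))

end Moments

/-! ### Directional derivative of the multipliers in the prior. -/

section Segment

variable {Ω : Type*} [MeasurableSpace Ω] {L : ℕ} {R : Ω → EuclideanSpace ℝ (Fin L)}
  {μ ν : Measure Ω} {m : EuclideanSpace ℝ (Fin L)} {C ε : ℝ}

theorem segment_zero (μ ν : Measure Ω) : segment μ ν 0 = μ := by simp [segment]

theorem isProbabilityMeasure_segment [IsProbabilityMeasure μ] [IsProbabilityMeasure ν]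
    (h0 : 0 ≤ ε) (h1 : ε ≤ 1) : IsProbabilityMeasure (segment μ ν ε) := by
  constructor
  simp [segment, ← ENNReal.ofReal_add (sub_nonneg.2 h1) h0]

/-- Lets `Spread` pass from `μ` to every segment point except the endpoint `ν`. -/
theorem absolutelyContinuous_segment (μ ν : Measure Ω) (h1 : ε < 1) : μ ≪ segment μ ν ε := by
  refine Measure.AbsolutelyContinuous.add_right ?_ _
  exact Measure.absolutelyContinuous_smul (by simpa using h1)

theorem integral_segment {F : Type*} [NormedAddCommGroup F] [NormedSpace ℝ F] {g : Ω → F}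
    (hμ : Integrable g μ) (hν : Integrable g ν) (h0 : 0 ≤ ε) (h1 : ε ≤ 1) :
    ∫ x, g x ∂(segment μ ν ε) = (1 - ε) • ∫ x, g x ∂μ + ε • ∫ x, g x ∂ν := by
  rw [segment, integral_add_measure (hμ.smul_measure ENNReal.ofReal_ne_top)
    (hν.smul_measure ENNReal.ofReal_ne_top), integral_smul_measure, integral_smul_measure,
    ENNReal.toReal_ofReal (sub_nonneg.2 h1), ENNReal.toReal_ofReal h0]

variable [IsProbabilityMeasure μ] [IsProbabilityMeasure ν]

theorem Spread.continuousWithinAt_multiplier_segment (h : Spread (fun x => R x - m) μ)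
    (hR : StronglyMeasurable R) (hRC : ∀ x, ‖R x‖ ≤ C) :
    ContinuousWithinAt (fun ε => multiplier R m (segment μ ν ε)) (Set.Ico 0 1) 0 := by
  have hY : ∀ ρ : Measure Ω, AEStronglyMeasurable (fun x => R x - m) ρ := fun ρ =>
    (hR.sub stronglyMeasurable_const).aestronglyMeasurable
  have hYC := norm_sub_le_of_norm_le hRC m
  have hseg : ∀ ε ∈ Set.Ico (0 : ℝ) 1, ∀ l,
      (1 - ε) * ∫ x, Real.exp ⟪l, R x - m⟫ ∂μ + ε * ∫ x, Real.exp ⟪l, R x - m⟫ ∂ν =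
        ∫ x, Real.exp ⟪l, R x - m⟫ ∂(segment μ ν ε) := fun ε hε l =>
    (integral_segment (integrable_exp_inner (hY μ) hYC l) (integrable_exp_inner (hY ν) hYC l)
      hε.1 hε.2.le).symm
  -- This formula, affine in `ε`, is continuous for all real `ε`, whereas `segment` truncates
  -- negative weights to zero.
  refine continuousWithinAt_of_convex_min (Z := fun ε l =>
    (1 - ε) * ∫ x, Real.exp ⟪l, R x - m⟫ ∂μ + ε * ∫ x, Real.exp ⟪l, R x - m⟫ ∂ν) ?_ ?_ ?_ ?_
  · have h1 := (continuous_integral_exp_inner (hY μ) hYC).comp (continuous_snd (X := ℝ))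
    have h2 := (continuous_integral_exp_inner (hY ν) hYC).comp (continuous_snd (X := ℝ))
    exact ((continuous_const.sub continuous_fst).mul h1).add (continuous_fst.mul h2)
  · intro ε hε
    have := isProbabilityMeasure_segment (μ := μ) (ν := ν) hε.1 hε.2.le
    simp_rw [hseg ε hε]
    exact convexOn_integral_exp_inner (hY _) hYC
  · intro ε hε
    have := isProbabilityMeasure_segment (μ := μ) (ν := ν) hε.1 hε.2.le
    simp_rw [hseg ε hε]
    exact integral_exp_inner_le_of_critical (hY _) hYC ((isMultiplier_iff_critical hR hRC).1
      ((h.mono_ac (absolutelyContinuous_segment μ ν hε.2)).isMultiplier_multiplier hR hRC))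
  · intro l hl
    rw [segment_zero] at hl ⊢
    have := h.integral_exp_inner_lt (hY _) hYC
      ((isMultiplier_iff_critical hR hRC).1 (h.isMultiplier_multiplier hR hRC)) hl
    simpa using this

/-- The moments with respect to the tilts of `μ` of the multipliers along a segment. -/
theorem Spread.gradient_logPartition_multiplier_segment (h : Spread (fun x => R x - m) μ)
    (hR : StronglyMeasurable R) (hRC : ∀ x, ‖R x‖ ≤ C) (hε : ε ∈ Set.Ico (0 : ℝ) 1) :
    gradient (fun l => logPartition R l μ) (multiplier R m (segment μ ν ε)) - m =
      ε • -((∫ x, Real.exp ⟪multiplier R m (segment μ ν ε), R x⟫ ∂μ)⁻¹ •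
        (∫ x, Real.exp ⟪multiplier R m (segment μ ν ε), R x⟫ • (R x - m) ∂ν -
          ∫ x, Real.exp ⟪multiplier R m (segment μ ν ε), R x⟫ • (R x - m) ∂μ)) := by
  have := isProbabilityMeasure_segment (μ := μ) (ν := ν) hε.1 hε.2.le
  have hY : ∀ ρ : Measure Ω, AEStronglyMeasurable (fun x => R x - m) ρ := fun ρ =>
    (hR.sub stronglyMeasurable_const).aestronglyMeasurable
  have hYC := norm_sub_le_of_norm_le hRC m
  have h0 := (isMultiplier_iff hR hRC).1 ((h.mono_ac
    (absolutelyContinuous_segment μ ν hε.2)).isMultiplier_multiplier hR hRC)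
  rw [integral_segment
    (integrable_exp_inner_smul hR.aestronglyMeasurable hRC (hY μ) hYC _)
    (integrable_exp_inner_smul hR.aestronglyMeasurable hRC (hY ν) hYC _) hε.1 hε.2.le] at h0
  rw [gradient_logPartition_sub hR hRC, ← smul_neg, smul_comm]
  congr 1
  -- The multiplier equation on the segment reads `(1 - ε) ∫ dμ + ε ∫ dν = 0`, so `∫ dμ` is `-ε`
  -- times the difference of the integrals.
  rw [← sub_eq_zero, ← h0]
  module

theorem exp_inner_sub_logPartition (hR : StronglyMeasurable R) (hRC : ∀ x, ‖R x‖ ≤ C)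
    (l : EuclideanSpace ℝ (Fin L)) (x : Ω) :
    Real.exp (⟪l, R x⟫ - logPartition R l μ) =
      (∫ x, Real.exp ⟪l, R x⟫ ∂μ)⁻¹ * Real.exp ⟪l, R x⟫ := by
  rw [Real.exp_sub, logPartition, Real.exp_log (integral_exp_inner_pos hR hRC l), div_eq_inv_mul]

/-- With `M ε` the gradient of `A(·, μ)` at the segment multiplier `l ε`, one has `l ε = multiplier
R (M ε) μ` for small `ε > 0`. Perturbing the prior thus becomes moving the moment. -/
theorem hasDirDeriv_multiplier (h : ∀ᶠ m' in 𝓝 m, Spread (fun x => R x - m') μ)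
    (hR : StronglyMeasurable R) (hRC : ∀ x, ‖R x‖ ≤ C)
    (hdiff : DifferentiableAt ℝ (fun m' => multiplier R m' μ) m) :
    HasDirDeriv (fun ρ => multiplier R m ρ) μ ν
      (-(fderiv ℝ (fun m' => multiplier R m' μ) m)
        ((∫ x, Real.exp (⟪multiplier R m μ, R x⟫ - logPartition R (multiplier R m μ) μ) •
            (R x - m) ∂ν) -
          ∫ x, Real.exp (⟪multiplier R m μ, R x⟫ - logPartition R (multiplier R m μ) μ) •
            (R x - m) ∂μ)) := by
  have hm := h.self_of_nhds
  have hY : ∀ ρ : Measure Ω, AEStronglyMeasurable (fun x => R x - m) ρ := fun ρ =>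
    (hR.sub stronglyMeasurable_const).aestronglyMeasurable
  have hYC := norm_sub_le_of_norm_le hRC m
  have hR' : ∀ ρ : Measure Ω, AEStronglyMeasurable R ρ := fun ρ => hR.aestronglyMeasurable
  set l : ℝ → EuclideanSpace ℝ (Fin L) := fun ε => multiplier R m (segment μ ν ε) with hl_def
  set M : ℝ → EuclideanSpace ℝ (Fin L) :=
    fun ε => gradient (fun l => logPartition R l μ) (l ε) with hM_def
  have hl0 : l 0 = multiplier R m μ := by rw [hl_def]; simp only [segment_zero]
  have hM0 : M 0 = m := by
    rw [hM_def]
    simp only [hl0]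
    exact HasGradientAt.gradient (hm.isMultiplier_multiplier hR hRC)
  have hIoo : ∀ᶠ ε : ℝ in 𝓝[>] 0, ε ∈ Set.Ioo (0 : ℝ) 1 := Ioo_mem_nhdsGT one_pos
  have hl : Tendsto l (𝓝[>] 0) (𝓝 (multiplier R m μ)) := by
    have h1 := (hm.continuousWithinAt_multiplier_segment (ν := ν) hR hRC).tendsto
    rw [segment_zero] at h1
    exact h1.mono_left (nhdsWithin_le_of_mem (mem_of_superset hIoo Set.Ioo_subset_Ico_self))
  -- The factor `ε` in `M ε - m` is explicit, so continuity of `l` at `0` already yields this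
  -- derivative.
  have hMder : HasDerivWithinAt M (-((∫ x, Real.exp ⟪multiplier R m μ, R x⟫ ∂μ)⁻¹ •
      (∫ x, Real.exp ⟪multiplier R m μ, R x⟫ • (R x - m) ∂ν -
        ∫ x, Real.exp ⟪multiplier R m μ, R x⟫ • (R x - m) ∂μ))) (Set.Ioi 0) 0 := by
    rw [hasDerivWithinAt_iff_tendsto_slope' (by simp)]
    have h1 := ((continuous_integral_exp_inner (hR' μ) hRC).tendsto _).comp hl
    have h2 := ((continuous_integral_exp_inner_smul (hR' ν) hRC (hY ν) hYC).tendsto _).comp hl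
    have h3 := ((continuous_integral_exp_inner_smul (hR' μ) hRC (hY μ) hYC).tendsto _).comp hl
    refine ((h1.inv₀ (integral_exp_inner_pos hR hRC _).ne').smul (h2.sub h3)).neg.congr' ?_
    filter_upwards [hIoo] with ε hε
    rw [slope_def_module, hM0, sub_zero, hM_def, hl_def]
    simp only
    rw [hm.gradient_logPartition_multiplier_segment hR hRC ⟨hε.1.le, hε.2⟩,
      inv_smul_smul₀ hε.1.ne']
    rfl
  have hMlim : Tendsto M (𝓝[>] 0) (𝓝 m) := by
    simpa [hM0] using hMder.continuousWithinAt.tendsto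
  have hcomp := HasFDerivAt.comp_hasDerivWithinAt_of_eq 0 hdiff.hasFDerivAt hMder hM0.symm
  rw [hasDerivWithinAt_iff_tendsto_slope' (by simp)] at hcomp
  simp_rw [exp_inner_sub_logPartition hR hRC, mul_smul, integral_smul, ← smul_sub]
  rw [← map_neg]
  refine hcomp.congr' ?_
  filter_upwards [hIoo, hMlim.eventually h] with ε hε hMε
  have hinv : ∀ {ε}, Spread (fun x => R x - M ε) μ → multiplier R (M ε) μ = l ε := fun hε =>
    (hε.eq_multiplier hR hRC ((isMultiplier_iff_gradient hR hRC).2 rfl)).symm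
  rw [slope_def_module, sub_zero]
  simp only [Function.comp]
  rw [hinv hMε, hM0]

end Segment

end EntropyMatching

/-! ### Assembly of the theorem. -/

open EntropyMatching in
theorem theorem4p8 {Ω : Type*} [TopologicalSpace Ω] [PolishSpace Ω] [MeasurableSpace Ω]
    [BorelSpace Ω] {L : ℕ} (R : Ω → EuclideanSpace ℝ (Fin L)) (hRc : Continuous R)
    (hRb : ∃ C : ℝ, ∀ x, ‖R x‖ ≤ C) :
    -- the objects are well defined
    (∀ (m : EuclideanSpace ℝ (Fin L)) (μ : ProbabilityMeasure Ω), (m, μ) ∈ matchDomain R →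
      (IsMatching R m μ (matching R m μ) ∧ ∀ ν, IsMatching R m μ ν → ν = matching R m μ) ∧
      klDiv (matching R m μ : Measure Ω) (μ : Measure Ω) ≠ ⊤ ∧
      IsMultiplier R m μ (multiplier R m μ) ∧
      (matching R m μ : Measure Ω) = expFamily R (multiplier R m μ) μ ∧
      ((m, μ) ∈ regularDomain R → ∀ l, IsMultiplier R m μ l → l = multiplier R m μ)) ∧
    -- (i) Pythagorean identity
    (∀ (m : EuclideanSpace ℝ (Fin L)) (μ ν : ProbabilityMeasure Ω), (m, μ) ∈ matchDomain R →
      (ν : Measure Ω) ≪ (μ : Measure Ω) → ∫ x, R x ∂(ν : Measure Ω) = m →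
      klDiv (ν : Measure Ω) (μ : Measure Ω) =
        klDiv (ν : Measure Ω) (matching R m μ : Measure Ω) +
          klDiv (matching R m μ : Measure Ω) (μ : Measure Ω)) ∧
    -- (ii) joint continuity at the nondegenerate points of the domain
    (∀ p ∈ regularDomain R,
      ContinuousWithinAt
        (fun q : EuclideanSpace ℝ (Fin L) × ProbabilityMeasure Ω => matching R q.1 q.2)
        (matchDomain R) p ∧
      ContinuousWithinAt
        (fun q : EuclideanSpace ℝ (Fin L) × ProbabilityMeasure Ω => multiplier R q.1 q.2)
        (matchDomain R) p ∧
      ContinuousWithinAt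
        (fun q : EuclideanSpace ℝ (Fin L) × ProbabilityMeasure Ω =>
          klDiv (matching R q.1 q.2 : Measure Ω) (q.2 : Measure Ω))
        (matchDomain R) p) ∧
    -- (iii) derivative of the multipliers with respect to the moments
    (∀ μ : ProbabilityMeasure Ω, LinIndepMod (withOne R) (μ : Measure Ω) →
      ∀ m ∈ interior (momentSpace (μ : Measure Ω).support R),
        (hessLogPartition R (multiplier R m μ) μ).IsInvertible ∧
        HasFDerivAt (fun m' => multiplier R m' (μ : Measure Ω))
          (hessLogPartition R (multiplier R m μ) μ).inverse m) ∧
    -- (iv) directional derivative of the multipliers with respect to the prior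
    (∀ (m : EuclideanSpace ℝ (Fin L)) (μ ν : ProbabilityMeasure Ω),
      (m, μ) ∈ regularDomain R → (m, ν) ∈ matchDomain R →
      (∀ ε ∈ Set.Ico (0 : ℝ) 1,
        IsMultiplier R m (segment (μ : Measure Ω) ν ε)
          (multiplier R m (segment (μ : Measure Ω) ν ε)) ∧
        ∀ l, IsMultiplier R m (segment (μ : Measure Ω) ν ε) l →
          l = multiplier R m (segment (μ : Measure Ω) ν ε)) ∧
      HasDirDeriv (fun ρ => multiplier R m ρ) (μ : Measure Ω) (ν : Measure Ω)
        (-(fderiv ℝ (fun m' => multiplier R m' (μ : Measure Ω)) m)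
          ((∫ x, Real.exp (⟪multiplier R m μ, R x⟫ - logPartition R (multiplier R m μ) μ) •
              (R x - m) ∂(ν : Measure Ω)) -
            ∫ x, Real.exp (⟪multiplier R m μ, R x⟫ - logPartition R (multiplier R m μ) μ) •
              (R x - m) ∂(μ : Measure Ω)))) := by
  obtain ⟨C, hRC⟩ := hRb
  have hm := hRc.stronglyMeasurable
  have hspread : ∀ {p : EuclideanSpace ℝ (Fin L) × ProbabilityMeasure Ω}, p ∈ regularDomain R →
      Spread (fun x => R x - p.1) (p.2 : Measure Ω) := fun hp =>
    spread_of_mem_interior_momentSpace hRc hRC hp.2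
  have hmult : ∀ q ∈ matchDomain R, IsMultiplier R q.1 (q.2 : Measure Ω)
      (multiplier R q.1 (q.2 : Measure Ω)) := by
    rintro ⟨m, μ⟩ (hq | hq)
    · exact (hspread hq).isMultiplier_multiplier hm hRC
    -- The degenerate branch: `0` is a multiplier, so the fixed choice is one too.
    · obtain rfl : m = ∫ x, R x ∂(μ : Measure Ω) := hq
      exact isMultiplier_multiplier (isMultiplier_zero hm hRC)
  have hnear : ∀ (μ : ProbabilityMeasure Ω) (m : EuclideanSpace ℝ (Fin L)),
      m ∈ interior (momentSpace (μ : Measure Ω).support R) →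
      ∀ᶠ m' in 𝓝 m, Spread (fun x => R x - m') (μ : Measure Ω) := fun μ m hmi => by
    filter_upwards [isOpen_interior.mem_nhds hmi] with m' hm'
    exact spread_of_mem_interior_momentSpace hRc hRC hm'
  refine ⟨fun m μ hq => ?_, fun m μ ν hq hac hν => ?_, fun p hp => ?_, fun μ _ m hmi => ?_,
    fun m μ ν hq _ => ⟨fun ε hε => ?_, ?_⟩⟩
  · have hl := hmult _ hq
    refine ⟨⟨hl.isMatching_matching hm hRC, fun ν hν => Subtype.ext ?_⟩, ?_, hl,
      hl.coe_matching hm hRC, fun hreg l hl' => (hspread hreg).eq_multiplier hm hRC hl'⟩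
    · exact (hl.coe_eq_expFamily hm hRC hν).trans (hl.coe_matching hm hRC).symm
    · rw [hl.coe_matching hm hRC, hl.klDiv_expFamily hm hRC]
      exact ENNReal.ofReal_ne_top
  · have hl := hmult _ hq
    rw [hl.coe_matching hm hRC]
    exact hl.klDiv_eq_add hm hRC hac hν
  · exact ⟨(hspread hp).continuousWithinAt_matching hRc hRC hmult,
      (hspread hp).continuousWithinAt_multiplier hRc hRC hmult,
      (hspread hp).continuousWithinAt_klDiv_matching hRc hRC hmult⟩
  · have hs := hnear μ m hmi
    exact ⟨hs.self_of_nhds.isInvertible_hessLogPartition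
      (hs.self_of_nhds.isMultiplier_multiplier hm hRC) hm hRC, hasFDerivAt_multiplier hRc hRC hs⟩
  · have := isProbabilityMeasure_segment (μ := (μ : Measure Ω)) (ν := (ν : Measure Ω))
      hε.1 hε.2.le
    have hs := (hspread hq).mono_ac (absolutelyContinuous_segment (μ : Measure Ω) ν hε.2)
    exact ⟨hs.isMultiplier_multiplier hm hRC, fun l hl => hs.eq_multiplier hm hRC hl⟩
  · have hs := hnear μ m hq.2
    exact hasDirDeriv_multiplier hs hm hRC (hasFDerivAt_multiplier hRc hRC hs).differentiableAt
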